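/- All vector lattices are real. Let $E$ be a Dedekind complete vector lattice, and let $\mathrm{Orth}(E)$ be the space of orthomorphisms on $E$, i.e. of the order bounded linear operators $T:E\to E$ with $T(B)\subseteq B$ for every band $B$ of $E$, ordered by $S\le T$ if and only if $Sx\le Tx$ for all $x\ge 0$; it is a vector lattice. An ideal is a solid linear subspace. A vector sublattice $F$ of a vector lattice $G$ is order dense in $G$ if for every $x>0$ in $G$ there is $y\in F$ with $0<y\le x$. A universal completion of a vector lattice $G$ is a vector lattice $U$ that is Dedekind complete and laterally complete (every non-empty set of pairwise disjoint positive elements has a supremum) and that contains a vector lattice isomorphic copy of $G$ as an order dense vector sublattice. Then: (1) There exist an order dense ideal $I$ of $E$ and an order dense ideal $\mathcal I$ of $\mathrm{Orth}(E)$ such that $I$ and $\mathcal I$ are isomorphic vector lattices. (2) $E$ and $\mathrm{Orth}(E)$ have isomorphic universal completions: $E$ and $\mathrm{Orth}(E)$ each have a universal completion, and every universal completion of $E$ is isomorphic, as a vector lattice, to every universal completion of $\mathrm{Orth}(E)$. -/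

import Mathlib

universe u v w

section Ideals

variable {E : Type*} [AddCommGroup E] [Lattice E] [IsOrderedAddMonoid E] [Module ℝ E]

variable (E) in
/-- An (order) ideal of a vector lattice: a solid linear subspace. -/
structure VLIdeal extends Submodule ℝ E where
  solid : LatticeOrderedAddCommGroup.IsSolid carrier

namespace VLIdeal

theorem sup_mem (I : VLIdeal E) {x y : E} (hx : x ∈ I.toSubmodule) (hy : y ∈ I.toSubmodule) :
    x ⊔ y ∈ I.toSubmodule := by
  have h1 : |x| ⊔ |y| ∈ I.toSubmodule := by
    have h2 : |x| + |y| ∈ I.toSubmodule :=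
      add_mem (I.solid hx (by simp)) (I.solid hy (by simp))
    refine I.solid h2 ?_
    have h0 : 0 ≤ |x| ⊔ |y| := (abs_nonneg x).trans le_sup_left
    rw [abs_of_nonneg h0, abs_of_nonneg (add_nonneg (abs_nonneg x) (abs_nonneg y))]
    exact sup_le (le_add_of_nonneg_right (abs_nonneg y)) (le_add_of_nonneg_left (abs_nonneg x))
  refine I.solid h1 ?_
  have h0 : 0 ≤ |x| ⊔ |y| := (abs_nonneg x).trans le_sup_left
  rw [abs_of_nonneg h0]
  refine abs_le'.2 ⟨sup_le_sup (le_abs_self x) (le_abs_self y), ?_⟩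
  rw [neg_sup]
  exact inf_le_left.trans ((neg_le_abs x).trans le_sup_left)

theorem inf_mem (I : VLIdeal E) {x y : E} (hx : x ∈ I.toSubmodule) (hy : y ∈ I.toSubmodule) :
    x ⊓ y ∈ I.toSubmodule := by
  have h := neg_mem (I.sup_mem (neg_mem hx) (neg_mem hy))
  rwa [neg_sup, neg_neg, neg_neg] at h

/-- The lattice structure that an ideal inherits from the ambient vector lattice. -/
instance (I : VLIdeal E) : Lattice I.toSubmodule :=
  Subtype.lattice (fun _ _ hx hy => I.sup_mem hx hy) (fun _ _ hx hy => I.inf_mem hx hy)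

/-- A band: an ideal that contains the supremum of each of its subsets which has a supremum. -/
def IsBand (B : VLIdeal E) : Prop :=
  ∀ (D : Set E) (x : E), D ⊆ B.carrier → IsLUB D x → x ∈ B.carrier

end VLIdeal

/-- Order density of a subset `F` (in practice: a vector sublattice or an ideal) of `E`:
below every `x > 0` of `E` there is a `y > 0` in `F`. -/
def IsOrderDense (F : Set E) : Prop :=
  ∀ x : E, 0 < x → ∃ y ∈ F, 0 < y ∧ y ≤ x

end Ideals

/-- A vector lattice isomorphism: a linear bijection that preserves the lattice operations. -/
structure VLEquiv (E F : Type*) [AddCommGroup E] [Lattice E] [Module ℝ E]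
    [AddCommGroup F] [Lattice F] [Module ℝ F] extends E ≃ₗ[ℝ] F where
  map_sup' : ∀ x y : E, toFun (x ⊔ y) = toFun x ⊔ toFun y
  map_inf' : ∀ x y : E, toFun (x ⊓ y) = toFun x ⊓ toFun y

/-- A linear map that is an injective lattice homomorphism. -/
structure IsVLEmbedding {E F : Type*} [AddCommGroup E] [Lattice E] [Module ℝ E]
    [AddCommGroup F] [Lattice F] [Module ℝ F] (i : E →ₗ[ℝ] F) : Prop where
  map_sup : ∀ x y : E, i (x ⊔ y) = i x ⊔ i y
  map_inf : ∀ x y : E, i (x ⊓ y) = i x ⊓ i y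
  injective : Function.Injective i

/-- Lateral completeness: every non-empty set of pairwise disjoint positive elements has a
supremum. -/
def IsLaterallyComplete (U : Type*) [AddCommGroup U] [Lattice U] : Prop :=
  ∀ D : Set U, D.Nonempty → (∀ x ∈ D, 0 ≤ x) → D.Pairwise (fun x y => x ⊓ y = 0) →
    ∃ a, IsLUB D a

/-- `U` is a universal completion of `E`: `U` is Dedekind complete (this is the instance
`ConditionallyCompleteLattice U`: non-empty subsets that are bounded above have suprema) and
laterally complete, and `E` embeds in `U` as an order dense vector sublattice. -/
def IsUniversalCompletion (E : Type*) [AddCommGroup E] [Lattice E] [Module ℝ E]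
    (U : Type*) [AddCommGroup U] [ConditionallyCompleteLattice U] [Module ℝ U] : Prop :=
  IsLaterallyComplete U ∧
    ∃ i : E →ₗ[ℝ] U, IsVLEmbedding i ∧ IsOrderDense (Set.range i)

section Orthomorphisms

variable {E : Type*} [AddCommGroup E] [Lattice E] [IsOrderedAddMonoid E] [Module ℝ E]

/-- Order bounded operators map order bounded sets to order bounded sets. -/
def IsOrderBoundedOp (T : E →ₗ[ℝ] E) : Prop :=
  ∀ s : Set E, BddBelow s → BddAbove s → BddBelow (T '' s) ∧ BddAbove (T '' s)

/-- Band preserving operators leave every band invariant. -/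
def IsBandPreserving (T : E →ₗ[ℝ] E) : Prop :=
  ∀ B : VLIdeal E, B.IsBand → ∀ x ∈ B.carrier, T x ∈ B.carrier

theorem isOrderBoundedOp_add {S T : E →ₗ[ℝ] E} (hS : IsOrderBoundedOp S)
    (hT : IsOrderBoundedOp T) : IsOrderBoundedOp (S + T) := by
  intro s h1 h2
  obtain ⟨⟨a, ha⟩, ⟨b, hb⟩⟩ := hS s h1 h2
  obtain ⟨⟨c, hc⟩, ⟨d, hd⟩⟩ := hT s h1 h2
  refine ⟨⟨a + c, ?_⟩, ⟨b + d, ?_⟩⟩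
  · rintro _ ⟨x, hx, rfl⟩
    exact add_le_add (ha ⟨x, hx, rfl⟩) (hc ⟨x, hx, rfl⟩)
  · rintro _ ⟨x, hx, rfl⟩
    exact add_le_add (hb ⟨x, hx, rfl⟩) (hd ⟨x, hx, rfl⟩)

theorem isOrderBoundedOp_neg {T : E →ₗ[ℝ] E} (hT : IsOrderBoundedOp T) :
    IsOrderBoundedOp (-T) := by
  intro s h1 h2
  obtain ⟨⟨c, hc⟩, ⟨d, hd⟩⟩ := hT s h1 h2
  refine ⟨⟨-d, ?_⟩, ⟨-c, ?_⟩⟩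
  · rintro _ ⟨x, hx, rfl⟩
    exact neg_le_neg (hd ⟨x, hx, rfl⟩)
  · rintro _ ⟨x, hx, rfl⟩
    exact neg_le_neg (hc ⟨x, hx, rfl⟩)

variable [IsOrderedModule ℝ E]

theorem isOrderBoundedOp_smul {T : E →ₗ[ℝ] E} (hT : IsOrderBoundedOp T) (r : ℝ) :
    IsOrderBoundedOp (r • T) := by
  have key : ∀ (c : ℝ) (S : E →ₗ[ℝ] E), 0 ≤ c → IsOrderBoundedOp S →
      IsOrderBoundedOp (c • S) := by
    intro c S hc hS s h1 h2
    obtain ⟨⟨a, ha⟩, ⟨b, hb⟩⟩ := hS s h1 h2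
    refine ⟨⟨c • a, ?_⟩, ⟨c • b, ?_⟩⟩
    · rintro _ ⟨x, hx, rfl⟩
      exact smul_le_smul_of_nonneg_left (ha ⟨x, hx, rfl⟩) hc
    · rintro _ ⟨x, hx, rfl⟩
      exact smul_le_smul_of_nonneg_left (hb ⟨x, hx, rfl⟩) hc
  rcases le_total 0 r with h | h
  · exact key r T h hT
  · have := key (-r) (-T) (neg_nonneg.2 h) (isOrderBoundedOp_neg hT)
    rwa [smul_neg, neg_smul, neg_neg] at this

variable (E) in
/-- The linear space of orthomorphisms: the order bounded band preserving operators. -/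
def orthSubmodule : Submodule ℝ (E →ₗ[ℝ] E) where
  carrier := {T | IsOrderBoundedOp T ∧ IsBandPreserving T}
  zero_mem' := by
    refine ⟨fun s _ _ => ⟨⟨0, ?_⟩, ⟨0, ?_⟩⟩, fun B _ x _ => B.zero_mem⟩ <;>
    · rintro _ ⟨x, -, rfl⟩
      simp
  add_mem' := fun hS hT => ⟨isOrderBoundedOp_add hS.1 hT.1,
    fun B hB x hx => B.add_mem (hS.2 B hB x hx) (hT.2 B hB x hx)⟩
  smul_mem' := fun r _ hT => ⟨isOrderBoundedOp_smul hT.1 r,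
    fun B hB x hx => B.smul_mem r (hT.2 B hB x hx)⟩

variable (E) in
/-- `Orth E`, the orthomorphisms on `E`. -/
def Orth : Type _ := ↥(orthSubmodule E)

namespace Orth

instance : AddCommGroup (Orth E) := inferInstanceAs (AddCommGroup ↥(orthSubmodule E))

instance : Module ℝ (Orth E) := inferInstanceAs (Module ℝ ↥(orthSubmodule E))

/-- The operator underlying an orthomorphism. -/
def toOp (T : Orth E) : E →ₗ[ℝ] E := T.1

theorem toOp_injective : Function.Injective (toOp : Orth E → E →ₗ[ℝ] E) :=
  Subtype.val_injective

theorem toOp_add (S T : Orth E) (x : E) : (S + T).toOp x = S.toOp x + T.toOp x := rfl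

theorem toOp_sub (S T : Orth E) (x : E) : (S - T).toOp x = S.toOp x - T.toOp x := rfl

theorem toOp_smul (r : ℝ) (T : Orth E) (x : E) : (r • T).toOp x = r • T.toOp x := rfl

theorem toOp_zero (x : E) : (0 : Orth E).toOp x = 0 := rfl

/-- The operator order: `S ≤ T` if and only if `S x ≤ T x` for all `x ≥ 0`. -/
instance : PartialOrder (Orth E) where
  le S T := ∀ x : E, 0 ≤ x → S.toOp x ≤ T.toOp x
  le_refl _ _ _ := le_rfl
  le_trans _ _ _ h1 h2 x hx := (h1 x hx).trans (h2 x hx)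
  le_antisymm S T h1 h2 := by
    apply toOp_injective
    ext x
    have h : ∀ y : E, 0 ≤ y → S.toOp y = T.toOp y := fun y hy => (h1 y hy).antisymm (h2 y hy)
    rw [← posPart_sub_negPart x, map_sub, map_sub, h _ (posPart_nonneg x), h _ (negPart_nonneg x)]

theorem le_def {S T : Orth E} : S ≤ T ↔ ∀ x : E, 0 ≤ x → S.toOp x ≤ T.toOp x := Iff.rfl

instance : IsOrderedAddMonoid (Orth E) where
  add_le_add_left _ _ h R x hx := add_le_add_left (h x hx) (R.toOp x)

instance : IsOrderedModule ℝ (Orth E) where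
  smul_le_smul_of_nonneg_left _ hr _ _ h x hx := smul_le_smul_of_nonneg_left (h x hx) hr
  smul_le_smul_of_nonneg_right _ hT _ _ h x hx := smul_le_smul_of_nonneg_right h (hT x hx)

end Orth

end Orthomorphisms

section OrthLattice

variable {E : Type*} [AddCommGroup E] [ConditionallyCompleteLattice E] [IsOrderedAddMonoid E]
  [Module ℝ E] [IsOrderedModule ℝ E]

namespace Orth

open scoped Pointwise

/-- The value of the positive part of `T` at `x ≥ 0`, given by the Riesz–Kantorovich formula. -/
noncomputable def posFun (T : Orth E) (x : E) : E := sSup (T.toOp '' Set.Icc 0 x)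

theorem isLUB_posFun (T : Orth E) {x : E} (hx : 0 ≤ x) :
    IsLUB (T.toOp '' Set.Icc 0 x) (T.posFun x) :=
  isLUB_csSup ((Set.nonempty_Icc.2 hx).image _) (T.2.1 _ bddBelow_Icc bddAbove_Icc).2

theorem le_posFun (T : Orth E) {x u : E} (h0 : 0 ≤ u) (h1 : u ≤ x) :
    T.toOp u ≤ T.posFun x :=
  (T.isLUB_posFun (h0.trans h1)).1 ⟨u, ⟨h0, h1⟩, rfl⟩

theorem posFun_nonneg (T : Orth E) {x : E} (hx : 0 ≤ x) : 0 ≤ T.posFun x := by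
  simpa using T.le_posFun le_rfl hx

theorem posFun_zero (T : Orth E) : T.posFun 0 = 0 := by
  simp [posFun]

theorem posFun_add (T : Orth E) {x y : E} (hx : 0 ≤ x) (hy : 0 ≤ y) :
    T.posFun (x + y) = T.posFun x + T.posFun y := by
  apply le_antisymm
  · refine (T.isLUB_posFun (add_nonneg hx hy)).2 ?_
    rintro _ ⟨u, ⟨hu0, hu⟩, rfl⟩
    have h1 : 0 ≤ u - u ⊓ x := sub_nonneg.2 inf_le_left
    have h2 : u - u ⊓ x ≤ y := by
      rw [sub_le_iff_le_add, ← sub_le_iff_le_add']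
      exact le_inf (sub_le_self _ hy) (sub_le_iff_le_add.2 hu)
    have h3 : T.toOp u = T.toOp (u ⊓ x) + T.toOp (u - u ⊓ x) := by
      rw [← map_add, add_sub_cancel]
    rw [h3]
    exact add_le_add (T.le_posFun (le_inf hu0 hx) inf_le_right) (T.le_posFun h1 h2)
  · rw [← le_sub_iff_add_le]
    refine (T.isLUB_posFun hx).2 ?_
    rintro _ ⟨u, ⟨hu0, hu⟩, rfl⟩
    rw [le_sub_comm]
    refine (T.isLUB_posFun hy).2 ?_
    rintro _ ⟨v, ⟨hv0, hv⟩, rfl⟩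
    rw [le_sub_iff_add_le', ← map_add]
    exact T.le_posFun (add_nonneg hu0 hv0) (add_le_add hu hv)

theorem posFun_smul (T : Orth E) {r : ℝ} (hr : 0 ≤ r) {x : E} (hx : 0 ≤ x) :
    T.posFun (r • x) = r • T.posFun x := by
  have key : ∀ (c : ℝ) (y : E), 0 < c → 0 ≤ y → c • T.posFun y ≤ T.posFun (c • y) := by
    intro c y hc hy
    have h : T.posFun y ≤ c⁻¹ • T.posFun (c • y) := by
      refine (T.isLUB_posFun hy).2 ?_
      rintro _ ⟨u, ⟨hu0, hu⟩, rfl⟩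
      have h1 := T.le_posFun (smul_nonneg hc.le hu0) (smul_le_smul_of_nonneg_left hu hc.le)
      have h2 := smul_le_smul_of_nonneg_left h1 (inv_nonneg.2 hc.le)
      rwa [map_smul, inv_smul_smul₀ hc.ne'] at h2
    have h2 := smul_le_smul_of_nonneg_left h hc.le
    rwa [smul_inv_smul₀ hc.ne'] at h2
  rcases hr.eq_or_lt with rfl | hr
  · simp [posFun_zero]
  · refine le_antisymm ?_ (key r x hr hx)
    have h := key r⁻¹ (r • x) (inv_pos.2 hr) (smul_nonneg hr.le hx)
    rw [inv_smul_smul₀ hr.ne'] at h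
    have h2 := smul_le_smul_of_nonneg_left h hr.le
    rwa [smul_inv_smul₀ hr.ne'] at h2

/-- If `x = a - b` with `a, b ≥ 0`, then the extension of `posFun` can be computed from `a, b`. -/
theorem posFun_ext (T : Orth E) {x a b : E} (ha : 0 ≤ a) (hb : 0 ≤ b) (h : x = a - b) :
    T.posFun x⁺ - T.posFun x⁻ = T.posFun a - T.posFun b := by
  have h1 : x⁺ + b = a + x⁻ := by
    have h2 := posPart_sub_negPart x
    rw [← sub_eq_zero] at h2 ⊢
    rw [← h2]
    nth_rewrite 5 [h]
    abel
  have h2 := congrArg T.posFun h1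
  rw [T.posFun_add (posPart_nonneg x) hb, T.posFun_add ha (negPart_nonneg x)] at h2
  rw [sub_eq_sub_iff_add_eq_add, h2]

/-- The positive part of an orthomorphism, as an operator. -/
noncomputable def posOp (T : Orth E) : E →ₗ[ℝ] E where
  toFun x := T.posFun x⁺ - T.posFun x⁻
  map_add' x y := by
    have h := T.posFun_ext (x := x + y) (add_nonneg (posPart_nonneg x) (posPart_nonneg y))
      (add_nonneg (negPart_nonneg x) (negPart_nonneg y))
      (by rw [add_sub_add_comm, posPart_sub_negPart, posPart_sub_negPart])
    rw [h, T.posFun_add (posPart_nonneg x) (posPart_nonneg y),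
      T.posFun_add (negPart_nonneg x) (negPart_nonneg y), add_sub_add_comm]
  map_smul' r x := by
    simp only [RingHom.id_apply]
    rcases le_total 0 r with hr | hr
    · rw [T.posFun_ext (x := r • x) (smul_nonneg hr (posPart_nonneg x))
        (smul_nonneg hr (negPart_nonneg x)) (by rw [← smul_sub, posPart_sub_negPart]),
        T.posFun_smul hr (posPart_nonneg x), T.posFun_smul hr (negPart_nonneg x), smul_sub]
    · have hr' : 0 ≤ -r := neg_nonneg.2 hr
      rw [T.posFun_ext (x := r • x) (smul_nonneg hr' (negPart_nonneg x))
        (smul_nonneg hr' (posPart_nonneg x))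
        (by rw [← smul_sub, neg_smul, ← smul_neg, neg_sub, posPart_sub_negPart]),
        T.posFun_smul hr' (posPart_nonneg x), T.posFun_smul hr' (negPart_nonneg x), ← smul_sub,
        neg_smul, ← smul_neg, neg_sub]

theorem posOp_apply (T : Orth E) {x : E} (hx : 0 ≤ x) : T.posOp x = T.posFun x := by
  change T.posFun x⁺ - T.posFun x⁻ = _
  rw [posPart_of_nonneg hx, negPart_of_nonneg hx, posFun_zero, sub_zero]

theorem posOp_mem (T : Orth E) : T.posOp ∈ orthSubmodule E := by
  have mono : ∀ x y : E, x ≤ y → T.posOp x ≤ T.posOp y := by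
    intro x y h
    rw [← sub_nonneg, ← map_sub, posOp_apply _ (sub_nonneg.2 h)]
    exact T.posFun_nonneg (sub_nonneg.2 h)
  refine ⟨fun s ⟨a, ha⟩ ⟨b, hb⟩ => ⟨⟨T.posOp a, ?_⟩, ⟨T.posOp b, ?_⟩⟩, ?_⟩
  · rintro _ ⟨x, hx, rfl⟩
    exact mono _ _ (ha hx)
  · rintro _ ⟨x, hx, rfl⟩
    exact mono _ _ (hb hx)
  · intro B hB x hx
    have key : ∀ y : E, 0 ≤ y → |y| ≤ |x| → T.posFun y ∈ B.carrier := by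
      intro y hy hyx
      refine hB _ _ ?_ (T.isLUB_posFun hy)
      rintro _ ⟨u, ⟨hu0, hu⟩, rfl⟩
      refine T.2.2 B hB u (B.solid hx ?_)
      rw [abs_of_nonneg hu0]
      exact (hu.trans (le_abs_self y)).trans hyx
    refine B.sub_mem (key _ (posPart_nonneg x) ?_) (key _ (negPart_nonneg x) ?_)
    · rw [abs_of_nonneg (posPart_nonneg x)]
      exact sup_le (le_abs_self x) (abs_nonneg x)
    · rw [abs_of_nonneg (negPart_nonneg x)]
      exact sup_le (neg_le_abs x) (abs_nonneg x)

/-- The positive part of an orthomorphism. -/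
noncomputable def pos (T : Orth E) : Orth E := ⟨T.posOp, T.posOp_mem⟩

theorem isLUB_pos (T : Orth E) : IsLUB {T, 0} T.pos := by
  constructor
  · intro R hR
    rcases hR with h | h
    · intro x hx
      rw [h]
      exact (T.le_posFun hx le_rfl).trans_eq (T.posOp_apply hx).symm
    · intro x hx
      rw [Set.mem_singleton_iff.1 h]
      exact (T.posFun_nonneg hx).trans_eq (T.posOp_apply hx).symm
  · intro S hS x hx
    have hST : T ≤ S := hS (by simp)
    have hS0 : 0 ≤ S := hS (by simp)
    refine (T.posOp_apply hx).trans_le ((T.isLUB_posFun hx).2 ?_)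
    rintro _ ⟨u, ⟨hu0, hu⟩, rfl⟩
    have h := hS0 (x - u) (sub_nonneg.2 hu)
    rw [toOp_zero, map_sub, sub_nonneg] at h
    exact (hST u hu0).trans h

/-- When `E` is Dedekind complete, the operator order makes `Orth E` a lattice. -/
noncomputable instance : Lattice (Orth E) where
  sup S T := (S - T).pos + T
  inf S T := T - (T - S).pos
  le_sup_left S T := sub_le_iff_le_add.1 ((S - T).isLUB_pos.1 (by simp))
  le_sup_right S T := le_add_of_nonneg_left ((S - T).isLUB_pos.1 (by simp))
  sup_le S T R h1 h2 := by
    rw [← le_sub_iff_add_le]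
    refine (S - T).isLUB_pos.2 ?_
    rintro _ (rfl | rfl)
    · exact sub_le_sub_right h1 T
    · exact sub_nonneg.2 h2
  inf_le_left S T := by
    rw [sub_le_comm]
    exact (T - S).isLUB_pos.1 (by simp)
  inf_le_right S T := sub_le_self _ ((T - S).isLUB_pos.1 (by simp))
  le_inf R S T h1 h2 := by
    rw [le_sub_comm]
    refine (T - S).isLUB_pos.2 ?_
    rintro _ (rfl | rfl)
    · exact sub_le_sub_left h1 T
    · exact sub_nonneg.2 h2

end Orth

end OrthLattice

/-! A maximal disjoint system `S` of `E` plays the role of a unit. On the ideal generated by `S`,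
multiplication by `x` should be the orthomorphism `T` for which `T e`, with `e` in `S`, is the
component of `x` in the band of `e`. Orthomorphisms commute with band projections and their sign is
decided on `S` (`orth_nonneg`), so there is at most one such `T`, and `x ↦ T` is linear, injective
and positive in both directions. Existence comes from dyadic expansion: if `0 ≤ x ≤ e`, then `x = ∑
2^{-(k+1)} p_k e` with band projections `p_k`, and `∑ 2^{-(k+1)} p_k` maps `e` to `x`
(`exists_operator_apply_eq`). The range is an order dense ideal: if `|T|` is dominated by
multiplication by `|x|`, where `|x| ≤ n • s` and `s` is a finite sum of members of `S`, then `T` is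
multiplication by `T s`.

Hence `E` and `Orth E` share an order dense sublattice. By `exists_extension`, an order dense
embedding of `G` in a universally complete `V` extends to every Archimedean `F` in which `G` is
order dense: `u ≥ 0` goes to the supremum in `V` of the elements of `G` below `u`, which exists
because locally bounded subsets of `V` are bounded. Using this in both directions gives uniqueness.

A universal completion of `E` consists of germs of families indexed by band projections and
compatible with restriction. A germ has to be given only locally, so suprema that exist locally
glue. The extension theorem embeds `Orth E` in the same space. -/

set_option linter.unusedSectionVars false

/-! ### Archimedean vector lattices and extension of maps from the positive cone. -/

section VectorLatticeBasics

variable {E : Type*} [AddCommGroup E] [Lattice E] [IsOrderedAddMonoid E]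

theorem posPart_sub_eq_of_inf_eq_zero {a b : E} (h : a ⊓ b = 0) : (a - b)⁺ = a := by
  have h1 := inf_eq_sub_posPart_sub a b
  rw [h, eq_comm, sub_eq_zero] at h1
  exact h1.symm

theorem pos_of_nonneg_of_ne {a : E} (h : 0 ≤ a) (h' : a ≠ 0) : 0 < a := lt_of_le_of_ne h h'.symm

theorem negPart_ne_zero_of_not_nonneg {a : E} (h : ¬ 0 ≤ a) : a⁻ ≠ 0 :=
  fun h1 => h (negPart_eq_zero.1 h1)

/-- In a lattice ordered group, infima distribute over arbitrary suprema. -/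
theorem IsLUB.inf_left {S : Set E} {s : E} (hs : IsLUB S s) (x : E) :
    IsLUB ((fun a => x ⊓ a) '' S) (x ⊓ s) := by
  constructor
  · rintro _ ⟨a, ha, rfl⟩
    exact inf_le_inf_left x (hs.1 ha)
  · intro w hw
    have h : s ≤ w + (s - x)⁺ := by
      refine hs.2 fun a ha => ?_
      have h1 : a = x ⊓ a + (a - x)⁺ := by
        rw [inf_comm, inf_eq_sub_posPart_sub]; abel
      rw [h1]
      exact add_le_add (hw ⟨a, ha, rfl⟩) (posPart_mono (sub_le_sub_right (hs.1 ha) x))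
    rw [inf_comm, inf_eq_sub_posPart_sub]
    exact sub_le_iff_le_add.2 h

/-- The Archimedean property of an ordered group. -/
def IsArchimedean (E : Type*) [AddCommGroup E] [LE E] : Prop :=
  ∀ x y : E, (∀ n : ℕ, n • x ≤ y) → x ≤ 0

theorem isArchimedean_of_conditionallyComplete (E : Type*) [AddCommGroup E]
    [ConditionallyCompleteLattice E] [IsOrderedAddMonoid E] : IsArchimedean E := by
  intro x y h
  have hs : IsLUB (Set.range fun n : ℕ => n • x) (sSup (Set.range fun n : ℕ => n • x)) :=
    isLUB_csSup (Set.range_nonempty _) ⟨y, by rintro _ ⟨n, rfl⟩; exact h n⟩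
  have h1 : sSup (Set.range fun n : ℕ => n • x) ≤ sSup (Set.range fun n : ℕ => n • x) - x := by
    refine hs.2 ?_
    rintro _ ⟨n, rfl⟩
    have h2 : (n + 1) • x ≤ _ := hs.1 ⟨n + 1, rfl⟩
    rw [succ_nsmul] at h2
    exact le_sub_iff_add_le.2 h2
  simpa using h1

variable [Module ℝ E] [IsOrderedModule ℝ E]

theorem smul_inf_of_nonneg {r : ℝ} (hr : 0 ≤ r) (x y : E) : r • (x ⊓ y) = r • x ⊓ r • y := by
  rcases hr.eq_or_lt with rfl | hr
  · simp
  · exact (OrderIso.smulRight hr).map_inf x y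

theorem inf_nsmul_eq_zero {x y : E} (hx : 0 ≤ x) (hy : 0 ≤ y) (h : x ⊓ y = 0) (n : ℕ) :
    x ⊓ n • y = 0 := by
  refine le_antisymm ?_ (le_inf hx (nsmul_nonneg hy n))
  have h1 : x ⊓ n • y ≤ (n + 1) • x ⊓ (n + 1) • y := by
    refine inf_le_inf ?_ ?_
    · rw [succ_nsmul]; exact le_add_of_nonneg_left (nsmul_nonneg hx n)
    · rw [succ_nsmul]; exact le_add_of_nonneg_right hy
  refine h1.trans_eq ?_
  rw [← Nat.cast_smul_eq_nsmul ℝ, ← Nat.cast_smul_eq_nsmul ℝ, ← smul_inf_of_nonneg (by positivity),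
    h, smul_zero]

variable {F : Type*} [AddCommGroup F] [Lattice F] [IsOrderedAddMonoid F] [Module ℝ F]
  [IsOrderedModule ℝ F]

/-- Additivity gives homogeneity for natural numbers, and positivity gives monotonicity. With `m =
⌊n * r⌋₊`, both `n • f (r • x)` and `n • (r • f x)` lie between `m • f x` and `(m + 1) • f x`, so
`n` times their difference never exceeds `f x`. -/
theorem smul_of_additive_monotone (hF : IsArchimedean F) {f : E → F}
    (hadd : ∀ x y, 0 ≤ x → 0 ≤ y → f (x + y) = f x + f y) (hnn : ∀ x, 0 ≤ x → 0 ≤ f x)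
    {r : ℝ} (hr : 0 ≤ r) {x : E} (hx : 0 ≤ x) : f (r • x) = r • f x := by
  have hmono : ∀ a b, 0 ≤ a → a ≤ b → f a ≤ f b := by
    intro a b ha hab
    have h := hadd a (b - a) ha (sub_nonneg.2 hab)
    rw [add_sub_cancel] at h
    rw [h]
    exact le_add_of_nonneg_right (hnn _ (sub_nonneg.2 hab))
  have h0 : f 0 = 0 := by
    have h := hadd 0 0 le_rfl le_rfl
    simpa using h
  have hn : ∀ (n : ℕ) (y : E), 0 ≤ y → f (n • y) = n • f y := by
    intro n y hy
    induction n with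
    | zero => simp [h0]
    | succ n ih => rw [succ_nsmul, hadd _ _ (nsmul_nonneg hy n) hy, ih, succ_nsmul]
  suffices h : ∀ n : ℕ, n • (f (r • x) - r • f x) ≤ f x ∧ n • (r • f x - f (r • x)) ≤ f x from
    le_antisymm (sub_nonpos.1 (hF _ _ fun n => (h n).1)) (sub_nonpos.1 (hF _ _ fun n => (h n).2))
  intro n
  have hm0 : 0 ≤ (n : ℝ) * r := by positivity
  set m := ⌊(n : ℝ) * r⌋₊ with hm
  have hm1 : (m : ℝ) ≤ n * r := Nat.floor_le hm0
  have hm2 : (n : ℝ) * r ≤ (m + 1 : ℕ) := by push_cast; exact (Nat.lt_floor_add_one _).le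
  have hmid : f (((n : ℝ) * r) • x) = n • f (r • x) := by
    rw [mul_smul, Nat.cast_smul_eq_nsmul, hn _ _ (smul_nonneg hr hx)]
  have hlo : m • f x ≤ n • f (r • x) := by
    rw [← hmid, ← hn _ _ hx, ← Nat.cast_smul_eq_nsmul ℝ m]
    exact hmono _ _ (smul_nonneg (by positivity) hx) (smul_le_smul_of_nonneg_right hm1 hx)
  have hhi : n • f (r • x) ≤ (m + 1) • f x := by
    rw [← hmid, ← hn _ _ hx, ← Nat.cast_smul_eq_nsmul ℝ (m + 1)]
    exact hmono _ _ (smul_nonneg hm0 hx) (smul_le_smul_of_nonneg_right hm2 hx)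
  have hlo' : m • f x ≤ n • (r • f x) := by
    rw [← Nat.cast_smul_eq_nsmul ℝ, ← Nat.cast_smul_eq_nsmul ℝ, smul_smul]
    exact smul_le_smul_of_nonneg_right hm1 (hnn x hx)
  have hhi' : n • (r • f x) ≤ (m + 1) • f x := by
    rw [← Nat.cast_smul_eq_nsmul ℝ, ← Nat.cast_smul_eq_nsmul ℝ, smul_smul]
    exact smul_le_smul_of_nonneg_right hm2 (hnn x hx)
  rw [succ_nsmul] at hhi hhi'
  constructor
  · rw [nsmul_sub, sub_le_iff_le_add]
    exact hhi.trans ((add_comm _ _).le.trans (add_le_add_right hlo' _))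
  · rw [nsmul_sub, sub_le_iff_le_add]
    exact hhi'.trans ((add_comm _ _).le.trans (add_le_add_right hlo _))

/-- An additive positive map on the positive cone extends to a linear map. -/
theorem exists_linear_extension (hF : IsArchimedean F) {f : E → F}
    (hadd : ∀ x y, 0 ≤ x → 0 ≤ y → f (x + y) = f x + f y) (hnn : ∀ x, 0 ≤ x → 0 ≤ f x) :
    ∃ L : E →ₗ[ℝ] F, ∀ x, 0 ≤ x → L x = f x := by
  have hext : ∀ x a b : E, 0 ≤ a → 0 ≤ b → x = a - b → f x⁺ - f x⁻ = f a - f b := by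
    intro x a b ha hb h
    have h1 : x⁺ + b = a + x⁻ := by
      rw [← sub_eq_sub_iff_add_eq_add, posPart_sub_negPart, h]
    have h2 := congrArg f h1
    rw [hadd _ _ (posPart_nonneg x) hb, hadd _ _ ha (negPart_nonneg x)] at h2
    rw [sub_eq_sub_iff_add_eq_add, h2]
  have hsm := fun {r : ℝ} (hr : 0 ≤ r) {x : E} (hx : 0 ≤ x) =>
    smul_of_additive_monotone hF hadd hnn hr hx
  refine ⟨{ toFun := fun x => f x⁺ - f x⁻, map_add' := fun x y => ?_, map_smul' := fun r x => ?_ },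
    fun x hx => ?_⟩
  · rw [hext (x + y) _ _ (add_nonneg (posPart_nonneg x) (posPart_nonneg y))
      (add_nonneg (negPart_nonneg x) (negPart_nonneg y))
      (by rw [add_sub_add_comm, posPart_sub_negPart, posPart_sub_negPart]),
      hadd _ _ (posPart_nonneg x) (posPart_nonneg y),
      hadd _ _ (negPart_nonneg x) (negPart_nonneg y), add_sub_add_comm]
  · simp only [RingHom.id_apply]
    rcases le_total 0 r with hr | hr
    · rw [hext (r • x) _ _ (smul_nonneg hr (posPart_nonneg x))
        (smul_nonneg hr (negPart_nonneg x)) (by rw [← smul_sub, posPart_sub_negPart]),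
        hsm hr (posPart_nonneg x), hsm hr (negPart_nonneg x), smul_sub]
    · have hr' : 0 ≤ -r := neg_nonneg.2 hr
      rw [hext (r • x) _ _ (smul_nonneg hr' (negPart_nonneg x))
        (smul_nonneg hr' (posPart_nonneg x))
        (by rw [← smul_sub, neg_smul, ← smul_neg, neg_sub, posPart_sub_negPart]),
        hsm hr' (posPart_nonneg x), hsm hr' (negPart_nonneg x), ← smul_sub,
        neg_smul, ← smul_neg, neg_sub]
  · have h0 : f 0 = 0 := by
      have h := hadd 0 0 le_rfl le_rfl
      simpa using h
    change f x⁺ - f x⁻ = f x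
    rw [posPart_of_nonneg hx, negPart_of_nonneg hx, h0, sub_zero]

/-- The images of `z⁺` and `z⁻` are disjoint with difference `T z`, and such a decomposition is
unique. Since `⊔` and `⊓` are expressed by positive parts, preserving disjointness suffices for a
lattice homomorphism. -/
theorem map_posPart_of_disjoint {T : E →ₗ[ℝ] F} (hT : ∀ x y, x ⊓ y = 0 → T x ⊓ T y = 0) (z : E) :
    T z⁺ = (T z)⁺ := by
  conv_rhs => rw [← posPart_sub_negPart z, map_sub]
  rw [posPart_sub_eq_of_inf_eq_zero (hT _ _ (posPart_inf_negPart_eq_zero z))]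

theorem map_sup_of_disjoint {T : E →ₗ[ℝ] F} (hT : ∀ x y, x ⊓ y = 0 → T x ⊓ T y = 0) (x y : E) :
    T (x ⊔ y) = T x ⊔ T y := by
  rw [sup_eq_add_posPart_sub, map_add, map_posPart_of_disjoint hT, map_sub,
    ← sup_eq_add_posPart_sub]

theorem map_inf_of_disjoint {T : E →ₗ[ℝ] F} (hT : ∀ x y, x ⊓ y = 0 → T x ⊓ T y = 0) (x y : E) :
    T (x ⊓ y) = T x ⊓ T y := by
  rw [inf_eq_sub_posPart_sub, map_sub, map_posPart_of_disjoint hT, map_sub,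
    ← inf_eq_sub_posPart_sub]

end VectorLatticeBasics

/-! ### Band projections. -/

/-- Band projections, as idempotent linear maps between `0` and the identity. -/
structure IsBandProjection {E : Type*} [AddCommGroup E] [Lattice E] [Module ℝ E]
    (p : E →ₗ[ℝ] E) : Prop where
  idem : ∀ x, p (p x) = p x
  nonneg : ∀ x, 0 ≤ x → 0 ≤ p x
  le_self : ∀ x, 0 ≤ x → p x ≤ x

namespace IsBandProjection

section

variable {E : Type*} [AddCommGroup E] [Lattice E] [IsOrderedAddMonoid E] [Module ℝ E]
  [IsOrderedModule ℝ E]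
variable {p q : E →ₗ[ℝ] E}

theorem mono (hp : IsBandProjection p) {x y : E} (h : x ≤ y) : p x ≤ p y := by
  have := hp.nonneg _ (sub_nonneg.2 h)
  rwa [map_sub, sub_nonneg] at this

theorem zero : IsBandProjection (0 : E →ₗ[ℝ] E) :=
  ⟨fun _ => by simp, fun _ _ => by simp, fun _ h => by simpa using h⟩

theorem one : IsBandProjection (LinearMap.id : E →ₗ[ℝ] E) :=
  ⟨fun _ => rfl, fun _ h => h, fun _ _ => le_rfl⟩

theorem compl (hp : IsBandProjection p) : IsBandProjection (LinearMap.id - p) :=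
  ⟨fun x => by simp [hp.idem], fun x hx => by simpa using hp.le_self x hx,
    fun x hx => by simpa using hp.nonneg x hx⟩

/-- The range of a band projection is solid. -/
theorem eq_self_of_le (hp : IsBandProjection p) {x y : E} (hx : 0 ≤ x) (hxy : x ≤ y)
    (hy : p y = y) : p x = x := by
  have h := hp.compl.mono hxy
  have h1 := hp.compl.nonneg _ hx
  simp only [LinearMap.sub_apply, LinearMap.id_apply, hy, sub_self] at h h1
  exact (sub_eq_zero.1 (h.antisymm h1)).symm

theorem eq_self_of_le_apply (hp : IsBandProjection p) {x y : E} (hx : 0 ≤ x) (hxy : x ≤ p y) :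
    p x = x :=
  hp.eq_self_of_le hx hxy (hp.idem y)

theorem eq_zero_of_le (hp : IsBandProjection p) {x y : E} (hx : 0 ≤ x) (hxy : x ≤ y)
    (hy : p y = 0) : p x = 0 :=
  ((hp.mono hxy).trans_eq hy).antisymm (hp.nonneg _ hx)

theorem ext_nonneg {F : Type*} [AddCommGroup F] [Module ℝ F] {S T : E →ₗ[ℝ] F}
    (h : ∀ x, 0 ≤ x → S x = T x) : S = T := by
  ext x
  rw [← posPart_sub_negPart x, map_sub, map_sub, h _ (posPart_nonneg x), h _ (negPart_nonneg x)]

theorem absorb (hp : IsBandProjection p) (hq : IsBandProjection q) (x : E) :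
    p (q (p x)) = q (p x) := by
  have h : p ∘ₗ q ∘ₗ p = q ∘ₗ p := ext_nonneg fun x hx =>
    hp.eq_self_of_le_apply (hq.nonneg _ (hp.nonneg _ hx)) (hq.le_self _ (hp.nonneg _ hx))
  exact LinearMap.congr_fun h x

/-- By `absorb`, `q` maps the range of `p` into itself; applied to the complement of `p`, it says
that `q` also preserves the kernel. -/
theorem commute (hp : IsBandProjection p) (hq : IsBandProjection q) (x : E) :
    p (q x) = q (p x) := by
  have h1 := hp.absorb hq x
  have h2 := hp.compl.absorb hq x
  simp only [LinearMap.sub_apply, LinearMap.id_apply, map_sub, h1] at h2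
  rw [sub_self, sub_zero] at h2
  exact sub_right_injective h2

theorem comp (hp : IsBandProjection p) (hq : IsBandProjection q) : IsBandProjection (p ∘ₗ q) :=
  ⟨fun x => by simp only [LinearMap.comp_apply]; rw [hq.commute hp, hp.idem, hq.idem],
    fun x hx => hp.nonneg _ (hq.nonneg _ hx),
    fun x hx => (hp.le_self _ (hq.nonneg _ hx)).trans (hq.le_self _ hx)⟩

theorem disjoint (hp : IsBandProjection p) (x y : E) (h : x ⊓ y = 0) : p x ⊓ p y = 0 := by
  have hx : 0 ≤ x := h ▸ inf_le_left
  have hy : 0 ≤ y := h ▸ inf_le_right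
  refine le_antisymm ?_ (le_inf (hp.nonneg _ hx) (hp.nonneg _ hy))
  rw [← h]
  exact inf_le_inf (hp.le_self _ hx) (hp.le_self _ hy)

theorem map_sup (hp : IsBandProjection p) (x y : E) : p (x ⊔ y) = p x ⊔ p y :=
  map_sup_of_disjoint hp.disjoint x y

theorem map_inf (hp : IsBandProjection p) (x y : E) : p (x ⊓ y) = p x ⊓ p y :=
  map_inf_of_disjoint hp.disjoint x y

theorem map_posPart (hp : IsBandProjection p) (x : E) : p x⁺ = (p x)⁺ :=
  map_posPart_of_disjoint hp.disjoint x

theorem map_negPart (hp : IsBandProjection p) (x : E) : p x⁻ = (p x)⁻ := by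
  rw [← posPart_neg, hp.map_posPart, map_neg, posPart_neg]

theorem map_abs (hp : IsBandProjection p) (x : E) : p |x| = |p x| := by
  rw [abs, hp.map_sup, map_neg, abs]

/-- Order continuity: an upper bound of `p '' A` becomes one of `A` after adding the complementary
component `x - p x`. -/
theorem isLUB_image (hp : IsBandProjection p) {A : Set E} {x : E} (h : IsLUB A x) :
    IsLUB (p '' A) (p x) := by
  constructor
  · rintro _ ⟨a, ha, rfl⟩
    exact hp.mono (h.1 ha)
  · intro w hw
    have h1 : x ≤ w + (x - p x) := by
      refine h.2 fun a ha => ?_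
      have h2 := hp.compl.mono (h.1 ha)
      simp only [LinearMap.sub_apply, LinearMap.id_apply] at h2
      calc a = p a + (a - p a) := by abel
        _ ≤ _ := add_le_add (hw ⟨a, ha, rfl⟩) h2
    have h3 := sub_le_iff_le_add.2 h1
    rwa [sub_sub_cancel] at h3

end

section

variable {E : Type*} [AddCommGroup E] [ConditionallyCompleteLattice E] [IsOrderedAddMonoid E]
  [Module ℝ E] [IsOrderedModule ℝ E]

/-- The supremum of the elements of a solid additive part of the cone below a given element. -/
theorem exists_of_solid (B : Set E) (h0 : (0 : E) ∈ B) (hnn : ∀ x ∈ B, 0 ≤ x)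
    (hadd : ∀ x ∈ B, ∀ y ∈ B, x + y ∈ B) (hsol : ∀ x ∈ B, ∀ y, 0 ≤ y → y ≤ x → y ∈ B) :
    ∃ p : E →ₗ[ℝ] E, IsBandProjection p ∧ ∀ x, 0 ≤ x → IsLUB {b ∈ B | b ≤ x} (p x) := by
  have hlub : ∀ x, 0 ≤ x → IsLUB {b ∈ B | b ≤ x} (sSup {b ∈ B | b ≤ x}) := fun x hx =>
    isLUB_csSup ⟨0, h0, hx⟩ ⟨x, fun b hb => hb.2⟩
  obtain ⟨p, hp⟩ := exists_linear_extension (isArchimedean_of_conditionallyComplete E)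
    (f := fun x : E => sSup {b ∈ B | b ≤ x}) (fun x y hx hy => by
      have hsum := (hlub x hx).add (hlub y hy)
      refine (hlub _ (add_nonneg hx hy)).unique ⟨?_, fun w hw => hsum.2 ?_⟩
      · rintro b ⟨hb, hbxy⟩
        have h1 : b ⊓ x ∈ B := hsol b hb _ (le_inf (hnn b hb) hx) inf_le_left
        have h2 : b - b ⊓ x ∈ B :=
          hsol b hb _ (sub_nonneg.2 inf_le_left) (sub_le_self _ (le_inf (hnn b hb) hx))
        have h3 : b - b ⊓ x ≤ y := by
          rw [sub_le_iff_le_add, ← sub_le_iff_le_add']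
          exact le_inf (sub_le_self _ hy) (sub_le_iff_le_add.2 hbxy)
        exact hsum.1 ⟨b ⊓ x, ⟨h1, inf_le_right⟩, _, ⟨h2, h3⟩, add_sub_cancel _ _⟩
      · rintro _ ⟨a, ha, b, hb, rfl⟩
        exact hw ⟨hadd a ha.1 b hb.1, add_le_add ha.2 hb.2⟩)
    (fun x hx => (hlub x hx).1 ⟨h0, hx⟩)
  have hlub' : ∀ x, 0 ≤ x → IsLUB {b ∈ B | b ≤ x} (p x) := fun x hx => by
    rw [hp x hx]; exact hlub x hx
  have hnn' : ∀ x, 0 ≤ x → 0 ≤ p x := fun x hx => (hlub' x hx).1 ⟨h0, hx⟩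
  have hle : ∀ x, 0 ≤ x → p x ≤ x := fun x hx => (hlub' x hx).2 fun b hb => hb.2
  refine ⟨p, ⟨fun x => ?_, hnn', hle⟩, hlub'⟩
  have h : p ∘ₗ p = p := ext_nonneg fun x hx => by
    refine (hlub' _ (hnn' x hx)).unique ?_
    have : {b ∈ B | b ≤ p x} = {b ∈ B | b ≤ x} := by
      ext b
      exact ⟨fun hb => ⟨hb.1, hb.2.trans (hle x hx)⟩, fun hb => ⟨hb.1, (hlub' x hx).1 hb⟩⟩
    rw [this]
    exact hlub' x hx
  exact LinearMap.congr_fun h x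

/-- `p x` is the supremum of the elements below `x` in the positive cone of the principal ideal of
`e`. The last clause is minimality: by order continuity, whatever projection kills `e` kills the
whole band. -/
theorem exists_bandProj (e : E) : ∃ p : E →ₗ[ℝ] E, IsBandProjection p ∧ p e = e ∧
    (∀ x, 0 ≤ x → x ⊓ |e| = 0 → p x = 0) ∧
    ∀ q : E →ₗ[ℝ] E, IsBandProjection q → q e = 0 → ∀ x, q (p x) = 0 := by
  obtain ⟨p, hp, hlub⟩ := exists_of_solid {b : E | 0 ≤ b ∧ ∃ n : ℕ, b ≤ n • |e|}
    ⟨le_rfl, 0, by simp⟩ (fun x hx => hx.1)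
    (fun x ⟨hx, n, hn⟩ y ⟨hy, m, hm⟩ =>
      ⟨add_nonneg hx hy, n + m, by rw [add_nsmul]; exact add_le_add hn hm⟩)
    (fun x ⟨hx, n, hn⟩ y hy hyx => ⟨hy, n, hyx.trans hn⟩)
  refine ⟨p, hp, ?_, ?_, ?_⟩
  · have h1 : p |e| = |e| := (hp.le_self _ (abs_nonneg e)).antisymm
      ((hlub _ (abs_nonneg e)).1 ⟨⟨abs_nonneg e, 1, by simp⟩, le_rfl⟩)
    have h2 := hp.eq_self_of_le (posPart_nonneg e) (sup_le (le_abs_self e) (abs_nonneg e)) h1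
    have h3 := hp.eq_self_of_le (negPart_nonneg e) (sup_le (neg_le_abs e) (abs_nonneg e)) h1
    rw [← posPart_sub_negPart e, map_sub, h2, h3]
  · intro x hx hxe
    refine le_antisymm ((hlub x hx).2 ?_) (hp.nonneg x hx)
    rintro b ⟨⟨hb, n, hn⟩, hbx⟩
    rw [← inf_nsmul_eq_zero hx (abs_nonneg e) hxe n]
    exact le_inf hbx hn
  · intro q hq hqe x
    have h : q ∘ₗ p = 0 := ext_nonneg fun x hx => by
      refine le_antisymm ((hq.isLUB_image (hlub x hx)).2 ?_) (hq.nonneg _ (hp.nonneg _ hx))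
      rintro _ ⟨b, ⟨⟨hb, n, hn⟩, -⟩, rfl⟩
      refine (hq.mono hn).trans_eq ?_
      rw [map_nsmul, hq.map_abs, hqe, abs_zero, smul_zero]
      rfl
    exact LinearMap.congr_fun h x

end

end IsBandProjection

section BandProj

variable {E : Type*} [AddCommGroup E] [ConditionallyCompleteLattice E] [IsOrderedAddMonoid E]
  [Module ℝ E] [IsOrderedModule ℝ E]

/-- The projection onto the band generated by an element. -/
noncomputable def bandProj (e : E) : E →ₗ[ℝ] E := (IsBandProjection.exists_bandProj e).choose

theorem isBandProjection_bandProj (e : E) : IsBandProjection (bandProj e) :=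
  (IsBandProjection.exists_bandProj e).choose_spec.1

theorem bandProj_self (e : E) : bandProj e e = e :=
  (IsBandProjection.exists_bandProj e).choose_spec.2.1

theorem bandProj_of_disjoint {e x : E} (he : 0 ≤ e) (hx : 0 ≤ x) (h : x ⊓ e = 0) :
    bandProj e x = 0 :=
  (IsBandProjection.exists_bandProj e).choose_spec.2.2.1 x hx (by rwa [abs_of_nonneg he])

theorem IsBandProjection.apply_bandProj_of_apply_eq_zero {q : E →ₗ[ℝ] E} (hq : IsBandProjection q)
    {e : E} (h : q e = 0) (x : E) : q (bandProj e x) = 0 :=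
  (IsBandProjection.exists_bandProj e).choose_spec.2.2.2 q hq h x

theorem bandProj_of_le {e x : E} (hx : 0 ≤ x) (h : x ≤ e) : bandProj e x = x :=
  (isBandProjection_bandProj e).eq_self_of_le hx h (bandProj_self e)

theorem bandProj_bandProj_of_disjoint {d e : E} (hd : 0 ≤ d) (he : 0 ≤ e) (h : d ⊓ e = 0) (x : E) :
    bandProj d (bandProj e x) = 0 :=
  (isBandProjection_bandProj d).apply_bandProj_of_apply_eq_zero
    (bandProj_of_disjoint hd he (by rwa [inf_comm])) x

theorem bandProj_posPart_apply (z : E) : bandProj z⁺ z = z⁺ := by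
  have h : bandProj z⁺ (z⁺ - z⁻) = z⁺ := by
    rw [map_sub, bandProj_self, bandProj_of_disjoint (posPart_nonneg z) (negPart_nonneg z)
      (by rw [inf_comm]; exact posPart_inf_negPart_eq_zero z), sub_zero]
  rwa [posPart_sub_negPart] at h

end BandProj

/-! ### Maximal disjoint families and gluing of local bounds. -/

theorem exists_maximal_disjoint {E : Type*} [AddCommGroup E] [Lattice E] (P : E → Prop)
    (hP : ∀ x, P x → 0 < x) :
    ∃ D : Set E, (∀ x ∈ D, P x) ∧ D.Pairwise (fun x y => x ⊓ y = 0) ∧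
      ∀ x, P x → ∃ y ∈ D, y ⊓ x ≠ 0 := by
  obtain ⟨D, hD⟩ := zorn_subset
    {D : Set E | (∀ x ∈ D, P x) ∧ D.Pairwise (fun x y => x ⊓ y = 0)} (fun c hc hchain => by
      refine ⟨⋃₀ c, ⟨?_, ?_⟩, fun s hs => Set.subset_sUnion_of_mem hs⟩
      · rintro x ⟨s, hs, hx⟩
        exact (hc hs).1 x hx
      · exact (Set.pairwise_sUnion hchain.directedOn).2 fun s hs => (hc hs).2)
  refine ⟨D, hD.prop.1, hD.prop.2, fun x hx => ?_⟩
  by_contra! hcon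
  have hins : insert x D ∈
      {D : Set E | (∀ x ∈ D, P x) ∧ D.Pairwise (fun x y => x ⊓ y = 0)} := by
    refine ⟨?_, ?_⟩
    · rintro y (rfl | hy)
      · exact hx
      · exact hD.prop.1 y hy
    · exact hD.prop.2.insert fun y hy _ => ⟨by rw [inf_comm]; exact hcon y hy, hcon y hy⟩
  -- An `x` disjoint from all of `D` would belong to `D` by maximality, hence be disjoint from
  -- itself.
  have hmem : x ∈ D := hD.le_of_ge hins (Set.subset_insert x D) (Set.mem_insert x D)
  have h := hcon x hmem
  rw [inf_idem] at h
  exact (hP x hx).ne' h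

section LocallyBounded

variable {V : Type*} [AddCommGroup V] [ConditionallyCompleteLattice V] [IsOrderedAddMonoid V]
  [Module ℝ V] [IsOrderedModule ℝ V]

/-- In a universally complete vector lattice, locally bounded sets are bounded. -/
theorem IsLaterallyComplete.bddAbove_of_locally (hV : IsLaterallyComplete V) {A : Set V}
    (hA : ∀ v : V, 0 < v → ∃ w, 0 ≤ w ∧ w ⊓ v ≠ 0 ∧ ∃ b, 0 ≤ b ∧ ∀ a ∈ A, (a - b)⁺ ⊓ w = 0) :
    BddAbove A := by
  -- Disjointness of `(a - b)⁺` from `w` means that `b` bounds `a` on the band of `w`. On a maximal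
  -- disjoint family of such `w`, the components of the local bounds are glued by lateral
  -- completeness.
  obtain ⟨D, hDP, hDd, hDm⟩ := exists_maximal_disjoint
    (fun w : V => 0 < w ∧ ∃ b, 0 ≤ b ∧ ∀ a ∈ A, (a - b)⁺ ⊓ w = 0) (fun x hx => hx.1)
  choose! b hb using fun w hw => (hDP w hw).2
  -- `D` may be empty, hence the extra `0`.
  obtain ⟨c, hc⟩ := hV (insert 0 ((fun w => bandProj w (b w)) '' D)) (Set.insert_nonempty _ _)
    (by
      rintro x (rfl | ⟨w, hw, rfl⟩)
      · exact le_rfl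
      · exact (isBandProjection_bandProj w).nonneg _ (hb w hw).1)
    (by
      have hnn : ∀ w ∈ D, 0 ≤ bandProj w (b w) := fun w hw =>
        (isBandProjection_bandProj w).nonneg _ (hb w hw).1
      refine Set.Pairwise.insert ?_ ?_
      · rintro _ ⟨w, hw, rfl⟩ _ ⟨w', hw', rfl⟩ hne
        have hww : w ≠ w' := fun h => hne (by rw [h])
        have hz : 0 ≤ bandProj w (b w) ⊓ bandProj w' (b w') := le_inf (hnn w hw) (hnn w' hw')
        have h1 := (isBandProjection_bandProj w).eq_self_of_le_apply hz inf_le_left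
        have h2 := (isBandProjection_bandProj w').eq_self_of_le_apply hz inf_le_right
        have h3 := bandProj_bandProj_of_disjoint (hDP w hw).1.le (hDP w' hw').1.le
          (hDd hw hw' hww) (bandProj w (b w) ⊓ bandProj w' (b w'))
        rw [h2, h1] at h3
        exact h3
      · rintro _ ⟨w, hw, rfl⟩ _
        exact ⟨inf_eq_left.2 (hnn w hw), inf_eq_right.2 (hnn w hw)⟩)
  refine ⟨c, fun a ha => ?_⟩
  by_contra hac
  have hd : 0 < (a - c)⁺ := pos_of_nonneg_of_ne (posPart_nonneg _)
    (fun h => hac (sub_nonpos.1 (posPart_eq_zero.1 h)))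
  obtain ⟨w0, hw0, hw0d, b0, hb0, hb0'⟩ := hA _ hd
  have hpos : 0 < w0 ⊓ (a - c)⁺ := pos_of_nonneg_of_ne (le_inf hw0 hd.le) hw0d
  -- The part of `(a - c)⁺` in `w0` meets some `w` in `D` by maximality, but on the band of `w` one
  -- has `a ≤ b w ≤ c`.
  obtain ⟨w, hw, hne⟩ := hDm (w0 ⊓ (a - c)⁺) ⟨hpos, b0, hb0, fun a' ha' =>
    le_antisymm ((inf_le_inf_left _ inf_le_left).trans_eq (hb0' a' ha'))
      (le_inf (posPart_nonneg _) hpos.le)⟩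
  apply hne
  have hp := isBandProjection_bandProj w
  have ht : 0 ≤ w ⊓ (w0 ⊓ (a - c)⁺) := le_inf (hDP w hw).1.le hpos.le
  rw [← bandProj_of_le ht inf_le_left]
  refine hp.eq_zero_of_le ht (y := (a - c)⁺) (inf_le_right.trans inf_le_right) ?_
  rw [hp.map_posPart, posPart_eq_zero, map_sub, sub_nonpos]
  have h1 : bandProj w a ≤ bandProj w (b w) := by
    have h2 := bandProj_of_disjoint (hDP w hw).1.le (posPart_nonneg _) ((hb w hw).2 a ha)
    rwa [hp.map_posPart, posPart_eq_zero, map_sub, sub_nonpos] at h2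
  refine h1.trans ?_
  have h4 := hp.mono (hc.1 (Or.inr ⟨w, hw, rfl⟩))
  rwa [hp.idem] at h4

end LocallyBounded

/-! ### Extension of order dense embeddings and uniqueness of universal completions. -/

section Extension

open scoped Pointwise

variable {G : Type*} [AddCommGroup G] [Lattice G] [IsOrderedAddMonoid G] [Module ℝ G]
  [IsOrderedModule ℝ G]
variable {F : Type*} [AddCommGroup F] [Lattice F] [IsOrderedAddMonoid F] [Module ℝ F]
  [IsOrderedModule ℝ F]

namespace IsVLEmbedding

variable {i : G →ₗ[ℝ] F}

theorem le_iff (hi : IsVLEmbedding i) {x y : G} : i x ≤ i y ↔ x ≤ y := by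
  rw [← inf_eq_left, ← hi.map_inf, hi.injective.eq_iff, inf_eq_left]

theorem nonneg_iff (hi : IsVLEmbedding i) {x : G} : 0 ≤ i x ↔ 0 ≤ x := by
  rw [← map_zero i, hi.le_iff]

theorem pos_iff (hi : IsVLEmbedding i) {x : G} : 0 < i x ↔ 0 < x := by
  rw [lt_iff_le_not_ge, lt_iff_le_not_ge, ← map_zero i, hi.le_iff, hi.le_iff]

theorem map_posPart (hi : IsVLEmbedding i) (x : G) : i x⁺ = (i x)⁺ := by
  rw [posPart_def, posPart_def, hi.map_sup, map_zero]

theorem isLUB_of_image (hi : IsVLEmbedding i) {S : Set G} {x : G} (h : IsLUB (i '' S) (i x)) :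
    IsLUB S x :=
  ⟨fun _ hs => hi.le_iff.1 (h.1 ⟨_, hs, rfl⟩), fun w hw => hi.le_iff.1 (h.2 (by
    rintro _ ⟨s, hs, rfl⟩
    exact hi.le_iff.2 (hw hs)))⟩

/-- Order dense embeddings preserve suprema. -/
theorem isLUB_image (hi : IsVLEmbedding i) (hd : IsOrderDense (Set.range i)) {S : Set G} {x : G}
    (h : IsLUB S x) : IsLUB (i '' S) (i x) := by
  constructor
  · rintro _ ⟨s, hs, rfl⟩
    exact hi.le_iff.2 (h.1 hs)
  · intro w hw
    by_contra hxw
    have hpos : 0 < (i x - w)⁺ := pos_of_nonneg_of_ne (posPart_nonneg _)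
      (fun h => hxw (sub_nonpos.1 (posPart_eq_zero.1 h)))
    obtain ⟨_, ⟨y, rfl⟩, hy0, hy⟩ := hd _ hpos
    -- `S` lies below `x ⊓ w = x - (x - w)⁺`, so its upper bound `x` can be lowered by `y`.
    have h1 : x ≤ x - y := by
      refine h.2 fun s hs => hi.le_iff.1 ?_
      have h2 : i s ≤ i x ⊓ w := le_inf (hi.le_iff.2 (h.1 hs)) (hw ⟨s, hs, rfl⟩)
      rw [inf_eq_sub_posPart_sub] at h2
      rw [map_sub]
      exact h2.trans (sub_le_sub_left hy _)
    have h3 : y ≤ 0 := by simpa using h1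
    exact (hi.pos_iff.1 hy0).not_ge h3

/-- Elements of the positive cone are suprema of the elements of an order dense sublattice. -/
theorem isLUB_below (hi : IsVLEmbedding i) (hd : IsOrderDense (Set.range i))
    (hF : IsArchimedean F) {u : F} (hu : 0 ≤ u) : IsLUB (i '' {x | 0 ≤ x ∧ i x ≤ u}) u := by
  constructor
  · rintro _ ⟨x, hx, rfl⟩
    exact hx.2
  · intro w hw
    by_contra huw
    have hpos : 0 < (u - w)⁺ := pos_of_nonneg_of_ne (posPart_nonneg _)
      (fun h => huw (sub_nonpos.1 (posPart_eq_zero.1 h)))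
    obtain ⟨_, ⟨y, rfl⟩, hy0, hy⟩ := hd _ hpos
    have hy0' : 0 ≤ y := (hi.pos_iff.1 hy0).le
    -- If `n • i y ≤ u`, then `n • y` is among the elements bounded by `w`, so `n • i y ≤ u ⊓ w ≤ u
    -- - i y`, leaving room for one more `i y`.
    have key : ∀ n : ℕ, n • i y ≤ u := by
      intro n
      induction n with
      | zero => simpa using hu
      | succ n ih =>
        have h1 : i (n • y) ≤ w := hw ⟨n • y, ⟨nsmul_nonneg hy0' n, by rwa [map_nsmul]⟩, rfl⟩
        rw [map_nsmul] at h1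
        have h2 : n • i y ≤ u ⊓ w := le_inf ih h1
        rw [inf_eq_sub_posPart_sub] at h2
        rw [succ_nsmul]
        exact le_sub_iff_add_le.1 (h2.trans (sub_le_sub_left hy _))
    exact hy0.not_ge (hF _ _ key)

theorem le_iff_below (hi : IsVLEmbedding i) (hd : IsOrderDense (Set.range i))
    (hF : IsArchimedean F) {u u' : F} (hu : 0 ≤ u)
    (h : ∀ x, 0 ≤ x → i x ≤ u → i x ≤ u') : u ≤ u' :=
  (hi.isLUB_below hd hF hu).2 (by rintro _ ⟨x, hx, rfl⟩; exact h x hx.1 hx.2)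

variable {V : Type*} [AddCommGroup V] [ConditionallyCompleteLattice V] [IsOrderedAddMonoid V]
  [Module ℝ V] [IsOrderedModule ℝ V] {j : G →ₗ[ℝ] V}

/-- Below a given `v` choose `j x > 0`; some `n • i x` is not below `u`. An element `y` of `G` under
`(n • i x - u)⁺` marks a band on which `u ≤ n • i x`, so `n • j x` is a local bound there. This `y`
meets `x` because `y ≤ n • x`. -/
theorem bddAbove_image_below (hi : IsVLEmbedding i) (hid : IsOrderDense (Set.range i))
    (hF : IsArchimedean F) (hj : IsVLEmbedding j) (hjd : IsOrderDense (Set.range j))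
    (hV : IsLaterallyComplete V) (u : F) : BddAbove (j '' {x | 0 ≤ x ∧ i x ≤ u}) := by
  refine hV.bddAbove_of_locally fun v hv => ?_
  obtain ⟨_, ⟨x, rfl⟩, hx0, hxv⟩ := hjd v hv
  have hx0' := hj.pos_iff.1 hx0
  have hn : ∃ n : ℕ, ¬ n • i x ≤ u := by
    by_contra! hcon
    exact (hi.pos_iff.2 hx0').not_ge (hF _ _ hcon)
  obtain ⟨n, hn⟩ := hn
  by_cases hu : 0 ≤ u
  · have hpos : 0 < (n • i x - u)⁺ := pos_of_nonneg_of_ne (posPart_nonneg _)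
      (fun h => hn (sub_nonpos.1 (posPart_eq_zero.1 h)))
    obtain ⟨_, ⟨y, rfl⟩, hy0, hy⟩ := hid _ hpos
    have hy0' := hi.pos_iff.1 hy0
    refine ⟨j y, (hj.pos_iff.2 hy0').le, fun h => ?_, n • j x, nsmul_nonneg hx0.le n, ?_⟩
    · have h1 : j y ⊓ j x = 0 := by
        refine le_antisymm ?_ (le_inf (hj.nonneg_iff.2 hy0'.le) hx0.le)
        rw [← h]
        exact inf_le_inf_left _ hxv
      have h2 : y ⊓ x = 0 := hj.injective (by rw [hj.map_inf, h1, map_zero])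
      have h3 := inf_nsmul_eq_zero hy0'.le hx0'.le h2 n
      have h4 : y ≤ n • x := by
        rw [← hi.le_iff, map_nsmul]
        exact hy.trans (sup_le (sub_le_self _ hu) (nsmul_nonneg (hi.nonneg_iff.2 hx0'.le) n))
      rw [inf_eq_left.2 h4] at h3
      exact hy0'.ne' h3
    · rintro _ ⟨a, ⟨ha0, hau⟩, rfl⟩
      have h1 : (a - n • x)⁺ ⊓ y = 0 := by
        refine le_antisymm ?_ (le_inf (posPart_nonneg _) hy0'.le)
        rw [← hi.le_iff, hi.map_inf, hi.map_posPart, map_zero, map_sub, map_nsmul]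
        rw [← posPart_inf_negPart_eq_zero (u - n • i x), ← posPart_neg, neg_sub]
        exact inf_le_inf (posPart_mono (sub_le_sub_right hau _)) hy
      rw [← map_nsmul, ← map_sub, ← hj.map_posPart, ← hj.map_inf, h1, map_zero]
  · refine ⟨v, hv.le, by simpa using hv.ne', 0, le_rfl, ?_⟩
    rintro _ ⟨a, ⟨ha0, hau⟩, rfl⟩
    exact absurd ((hi.nonneg_iff.2 ha0).trans hau) hu

/-- An embedding of `G` as an order dense sublattice of a universally complete vector lattice
extends to every Archimedean vector lattice in which `G` is order dense. -/
theorem exists_extension (hi : IsVLEmbedding i) (hid : IsOrderDense (Set.range i))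
    (hF : IsArchimedean F) (hj : IsVLEmbedding j) (hjd : IsOrderDense (Set.range j))
    (hV : IsLaterallyComplete V) :
    ∃ T : F →ₗ[ℝ] V, IsVLEmbedding T ∧ ∀ x, T (i x) = j x := by
  have hVA := isArchimedean_of_conditionallyComplete V
  set f : F → V := fun u => sSup (j '' {x | 0 ≤ x ∧ i x ≤ u}) with hf
  have hlub : ∀ u, 0 ≤ u → IsLUB (j '' {x | 0 ≤ x ∧ i x ≤ u}) (f u) := fun u hu =>
    isLUB_csSup ⟨0, 0, ⟨le_rfl, by simpa using hu⟩, map_zero j⟩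
      (hi.bddAbove_image_below hid hF hj hjd hV u)
  have hnn : ∀ u, 0 ≤ u → 0 ≤ f u := fun u hu =>
    (hlub u hu).1 ⟨0, ⟨le_rfl, by simpa using hu⟩, map_zero j⟩
  -- `f u` has the same elements of `G` below it as `u`. If `j x ≤ f u`, distributivity makes `j x`
  -- the supremum of the `j (x ⊓ a)`; this supremum holds already in `G`, and `i` preserves it.
  have hbelow : ∀ u, 0 ≤ u → ∀ x, 0 ≤ x → (j x ≤ f u ↔ i x ≤ u) := by
    intro u hu x hx
    refine ⟨fun h => ?_, fun h => (hlub u hu).1 ⟨x, ⟨hx, h⟩, rfl⟩⟩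
    have h1 := (hlub u hu).inf_left (j x)
    rw [inf_eq_left.2 h, Set.image_image] at h1
    have h2 : IsLUB ((fun a => x ⊓ a) '' {a | 0 ≤ a ∧ i a ≤ u}) x :=
      hj.isLUB_of_image (by rw [Set.image_image]; simpa only [hj.map_inf] using h1)
    refine (hi.isLUB_image hid h2).2 ?_
    rintro _ ⟨_, ⟨a, ha, rfl⟩, rfl⟩
    rw [hi.map_inf]
    exact inf_le_right.trans ha.2
  have hadd : ∀ u u', 0 ≤ u → 0 ≤ u' → f (u + u') = f u + f u' := by
    intro u u' hu hu'
    refine (hlub _ (add_nonneg hu hu')).unique ⟨?_, fun w hw => ?_⟩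
    · rintro _ ⟨x, ⟨hx0, hx⟩, rfl⟩
      -- The same transfer: `x` is the supremum of the `x ⊓ (a + b)` in `F`, hence in `G`, hence in
      -- `V`.
      have h1 := ((hi.isLUB_below hid hF hu).add (hi.isLUB_below hid hF hu')).inf_left (i x)
      rw [inf_eq_left.2 hx] at h1
      have h2 : IsLUB ((fun a => x ⊓ a) ''
          ({a | 0 ≤ a ∧ i a ≤ u} + {a | 0 ≤ a ∧ i a ≤ u'})) x := by
        refine hi.isLUB_of_image ?_
        rw [Set.image_image]
        simp only [hi.map_inf]
        rwa [← Set.image_image (fun a => i x ⊓ a) i, Set.image_add]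
      refine (hj.isLUB_image hjd h2).2 ?_
      rintro _ ⟨_, ⟨_, ⟨a, ha, b, hb, rfl⟩, rfl⟩, rfl⟩
      simp only [hj.map_inf, map_add]
      exact inf_le_right.trans (add_le_add ((hlub u hu).1 ⟨a, ha, rfl⟩)
        ((hlub u' hu').1 ⟨b, hb, rfl⟩))
    · refine ((hlub u hu).add (hlub u' hu')).2 ?_
      rintro _ ⟨_, ⟨a, ha, rfl⟩, _, ⟨b, hb, rfl⟩, rfl⟩
      refine hw ⟨a + b, ⟨add_nonneg ha.1 hb.1, ?_⟩, map_add j a b⟩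
      rw [map_add]
      exact add_le_add ha.2 hb.2
  obtain ⟨T, hT⟩ := exists_linear_extension hVA hadd hnn
  have hdisj : ∀ u u', u ⊓ u' = 0 → T u ⊓ T u' = 0 := by
    intro u u' h
    have hu : 0 ≤ u := h ▸ inf_le_left
    have hu' : 0 ≤ u' := h ▸ inf_le_right
    rw [hT u hu, hT u' hu']
    have h0 := le_inf (hnn u hu) (hnn u' hu')
    refine le_antisymm (hj.le_iff_below hjd hVA h0 fun x hx hxu => ?_) h0
    have h1 : i x ≤ u ⊓ u' := le_inf ((hbelow u hu x hx).1 (hxu.trans inf_le_left))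
      ((hbelow u' hu' x hx).1 (hxu.trans inf_le_right))
    rw [h, ← map_zero i, hi.le_iff] at h1
    rw [h1.antisymm hx, map_zero]
  refine ⟨T, ⟨map_sup_of_disjoint hdisj, map_inf_of_disjoint hdisj, ?_⟩, fun x => ?_⟩
  · refine (injective_iff_map_eq_zero T).2 fun u hu => ?_
    have hz : ∀ z, 0 ≤ z → T z = 0 → z = 0 := by
      intro z hz h
      refine le_antisymm (hi.le_iff_below hid hF hz fun x hx hxz => ?_) hz
      have h1 := (hbelow z hz x hx).2 hxz
      rw [← hT z hz, h, ← map_zero j, hj.le_iff] at h1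
      rw [h1.antisymm hx, map_zero]
    have h1 : u⁺ = 0 := hz _ (posPart_nonneg u) (by
      rw [map_posPart_of_disjoint hdisj, hu, posPart_zero])
    have h2 : u⁻ = 0 := hz _ (negPart_nonneg u) (by
      rw [← posPart_neg, map_posPart_of_disjoint hdisj, map_neg, hu, neg_zero, posPart_zero])
    rw [← posPart_sub_negPart u, h1, h2, sub_zero]
  · have h : T ∘ₗ i = j := IsBandProjection.ext_nonneg fun x hx => by
      have hix := hi.nonneg_iff.2 hx
      rw [LinearMap.comp_apply, hT _ hix]
      refine le_antisymm ((hlub _ hix).2 ?_) ((hlub _ hix).1 ⟨x, ⟨hx, le_rfl⟩, rfl⟩)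
      rintro _ ⟨y, hy, rfl⟩
      exact hj.le_iff.2 (hi.le_iff.1 hy.2)
    exact LinearMap.congr_fun h x

end IsVLEmbedding

/-- Universally complete vector lattices that have a common order dense vector sublattice are
isomorphic. -/
theorem nonempty_vlEquiv_of_orderDense {U V : Type*}
    [AddCommGroup U] [ConditionallyCompleteLattice U] [IsOrderedAddMonoid U]
    [Module ℝ U] [IsOrderedModule ℝ U]
    [AddCommGroup V] [ConditionallyCompleteLattice V] [IsOrderedAddMonoid V]
    [Module ℝ V] [IsOrderedModule ℝ V]
    (hU : IsLaterallyComplete U) (hV : IsLaterallyComplete V)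
    {i : G →ₗ[ℝ] U} (hi : IsVLEmbedding i) (hid : IsOrderDense (Set.range i))
    {j : G →ₗ[ℝ] V} (hj : IsVLEmbedding j) (hjd : IsOrderDense (Set.range j)) :
    Nonempty (VLEquiv U V) := by
  have hUA := isArchimedean_of_conditionallyComplete U
  have hVA := isArchimedean_of_conditionallyComplete V
  obtain ⟨T, hT, hTi⟩ := hi.exists_extension hid hUA hj hjd hV
  obtain ⟨S, hS, hSj⟩ := hj.exists_extension hjd hVA hi hid hU
  -- `T (S v)` and `v` dominate the same elements of `G`, and an element of the positive cone is the
  -- supremum of these.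
  have h : T ∘ₗ S = LinearMap.id := IsBandProjection.ext_nonneg fun v hv => by
    have hiff : ∀ x, j x ≤ T (S v) ↔ j x ≤ v := fun x => by
      conv_lhs => rw [← hTi, hT.le_iff, ← hSj, hS.le_iff]
    exact le_antisymm
      (hj.le_iff_below hjd hVA (hT.nonneg_iff.2 (hS.nonneg_iff.2 hv)) fun x _ hx => (hiff x).1 hx)
      (hj.le_iff_below hjd hVA hv fun x _ hx => (hiff x).2 hx)
  exact ⟨{ LinearEquiv.ofBijective T ⟨hT.injective, fun v => ⟨S v, LinearMap.congr_fun h v⟩⟩ with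
    map_sup' := hT.map_sup
    map_inf' := hT.map_inf }⟩

end Extension

/-! ### A universal completion made of germs of compatible families. -/

open Filter

/-- The band projections of a vector lattice. -/
def BandProjection (E : Type*) [AddCommGroup E] [Lattice E] [Module ℝ E] : Type _ :=
  {p : E →ₗ[ℝ] E // IsBandProjection p}

namespace BandProjection

section

variable {E : Type*} [AddCommGroup E] [Lattice E] [IsOrderedAddMonoid E] [Module ℝ E]
  [IsOrderedModule ℝ E]

instance : CoeFun (BandProjection E) (fun _ => E → E) := ⟨fun p => p.1⟩

instance : CommMonoid (BandProjection E) where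
  mul p q := ⟨p.1 ∘ₗ q.1, p.2.comp q.2⟩
  one := ⟨LinearMap.id, IsBandProjection.one⟩
  mul_assoc _ _ _ := rfl
  one_mul _ := rfl
  mul_one _ := rfl
  mul_comm p q := Subtype.ext (LinearMap.ext fun x => p.2.commute q.2 x)

instance : Zero (BandProjection E) := ⟨⟨0, IsBandProjection.zero⟩⟩

theorem mul_apply (p q : BandProjection E) (x : E) : (p * q) x = p (q x) := rfl

theorem mul_self (p : BandProjection E) : p * p = p :=
  Subtype.ext (LinearMap.ext fun x => p.2.idem x)

theorem mul_mul_self (p q : BandProjection E) : p * (p * q) = p * q := by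
  rw [← mul_assoc, mul_self]

theorem eq_zero_of_forall {p : BandProjection E} (h : ∀ x, p x = 0) : p = 0 :=
  Subtype.ext (LinearMap.ext h)

theorem ne_zero_of_apply {p : BandProjection E} {x : E} (h : p x ≠ 0) : p ≠ 0 := by
  rintro rfl
  exact h rfl

variable (E) in
/-- The filter generated by the dense ideals of the Boolean algebra of band projections. -/
def denseFilter : Filter (BandProjection E) where
  sets := {S | ∀ p : BandProjection E, p ≠ 0 → ∃ s, s * p ≠ 0 ∧ ∀ t, t * (s * p) ∈ S}
  univ_sets := fun p hp => ⟨1, by rwa [one_mul], fun _ => trivial⟩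
  sets_of_superset := fun hS hST p hp => by
    obtain ⟨s, hs, h⟩ := hS p hp
    exact ⟨s, hs, fun t => hST (h t)⟩
  inter_sets := fun hS hT p hp => by
    obtain ⟨s, hs, h⟩ := hS p hp
    obtain ⟨s', hs', h'⟩ := hT _ hs
    refine ⟨s' * s, by rwa [mul_assoc], fun t => ⟨?_, ?_⟩⟩
    · rw [mul_assoc, ← mul_assoc]
      exact h _
    · rw [mul_assoc]
      exact h' t

theorem eventually_denseFilter {P : BandProjection E → Prop} :
    (∀ᶠ p in denseFilter E, P p) ↔
      ∀ p : BandProjection E, p ≠ 0 → ∃ s, s * p ≠ 0 ∧ ∀ t, P (t * (s * p)) := Iff.rfl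

/-- Compatibility of a family, indexed by band projections, with the restriction to smaller
band projections. -/
def IsCompatible (f : BandProjection E → E) (p : BandProjection E) : Prop :=
  ∀ s : BandProjection E, f (s * p) = s (f p)

namespace IsCompatible

variable {f g : BandProjection E → E} {p : BandProjection E}

theorem mul (h : IsCompatible f p) (t : BandProjection E) : IsCompatible f (t * p) := fun s => by
  rw [← mul_assoc, h, h, mul_apply]

theorem apply_self (h : IsCompatible f p) : p (f p) = f p := by
  rw [← h p, mul_self]

theorem add (hf : IsCompatible f p) (hg : IsCompatible g p) : IsCompatible (f + g) p := fun s => by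
  simp only [Pi.add_apply, hf s, hg s, map_add]

theorem sub (hf : IsCompatible f p) (hg : IsCompatible g p) : IsCompatible (f - g) p := fun s => by
  simp only [Pi.sub_apply, hf s, hg s, map_sub]

theorem smul (hf : IsCompatible f p) (r : ℝ) : IsCompatible (r • f) p := fun s => by
  simp only [Pi.smul_apply, hf s, map_smul]

theorem sup (hf : IsCompatible f p) (hg : IsCompatible g p) : IsCompatible (f ⊔ g) p := fun s => by
  simp only [Pi.sup_apply, hf s, hg s, s.2.map_sup]

theorem inf (hf : IsCompatible f p) (hg : IsCompatible g p) : IsCompatible (f ⊓ g) p := fun s => by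
  simp only [Pi.inf_apply, hf s, hg s, s.2.map_inf]

end IsCompatible

theorem isCompatible_apply (x : E) (p : BandProjection E) : IsCompatible (fun q => q x) p :=
  fun _ => rfl

variable (E) in
/-- The germs of compatible families. -/
def compatibleGerms : Submodule ℝ (Germ (denseFilter E) E) where
  carrier := {g | ∃ f : BandProjection E → E, g = f ∧ ∀ᶠ p in denseFilter E, IsCompatible f p}
  zero_mem' := ⟨0, rfl, Eventually.of_forall fun p s => by simp⟩
  add_mem' := by
    rintro _ _ ⟨f, rfl, hf⟩ ⟨g, rfl, hg⟩
    exact ⟨f + g, rfl, by filter_upwards [hf, hg] with p h1 h2 using h1.add h2⟩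
  smul_mem' := by
    rintro r _ ⟨f, rfl, hf⟩
    exact ⟨r • f, rfl, by filter_upwards [hf] with p h1 using h1.smul r⟩

variable (E) in
/-- The space of germs of compatible families of elements of `E`. -/
def GermSpace : Type _ := ↥(compatibleGerms E)

namespace GermSpace

instance : AddCommGroup (GermSpace E) := inferInstanceAs (AddCommGroup ↥(compatibleGerms E))

instance : Module ℝ (GermSpace E) := inferInstanceAs (Module ℝ ↥(compatibleGerms E))

instance : Lattice (GermSpace E) :=
  Subtype.lattice (P := fun g => g ∈ compatibleGerms E)
    (by
      rintro _ _ ⟨f, rfl, hf⟩ ⟨g, rfl, hg⟩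
      exact ⟨f ⊔ g, rfl, by filter_upwards [hf, hg] with p h1 h2 using h1.sup h2⟩)
    (by
      rintro _ _ ⟨f, rfl, hf⟩ ⟨g, rfl, hg⟩
      exact ⟨f ⊓ g, rfl, by filter_upwards [hf, hg] with p h1 h2 using h1.inf h2⟩)

instance : IsOrderedAddMonoid (GermSpace E) where
  add_le_add_left a b h c := by
    change a.1 + c.1 ≤ b.1 + c.1
    exact add_le_add_left (show a.1 ≤ b.1 from h) c.1

/-- A representative of an element of the germ space. -/
noncomputable def rep (a : GermSpace E) : BandProjection E → E := a.2.choose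

theorem val_eq_rep (a : GermSpace E) : a.1 = (a.rep : Germ (denseFilter E) E) :=
  a.2.choose_spec.1

theorem eventually_isCompatible_rep (a : GermSpace E) :
    ∀ᶠ p in denseFilter E, IsCompatible a.rep p :=
  a.2.choose_spec.2

/-- The germ of a compatible family. -/
def of (f : BandProjection E → E) (hf : ∀ᶠ p in denseFilter E, IsCompatible f p) : GermSpace E :=
  ⟨f, f, rfl, hf⟩

theorem le_iff {a b : GermSpace E} : a ≤ b ↔ ∀ᶠ p in denseFilter E, a.rep p ≤ b.rep p := by
  change a.1 ≤ b.1 ↔ _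
  rw [val_eq_rep, val_eq_rep]
  exact Germ.coe_le

theorem le_of_iff {a : GermSpace E} {f : BandProjection E → E}
    {hf : ∀ᶠ p in denseFilter E, IsCompatible f p} :
    a ≤ of f hf ↔ ∀ᶠ p in denseFilter E, a.rep p ≤ f p := by
  change a.1 ≤ _ ↔ _
  rw [val_eq_rep]
  exact Germ.coe_le

theorem of_le_iff {a : GermSpace E} {f : BandProjection E → E}
    {hf : ∀ᶠ p in denseFilter E, IsCompatible f p} :
    of f hf ≤ a ↔ ∀ᶠ p in denseFilter E, f p ≤ a.rep p := by
  change (f : Germ (denseFilter E) E) ≤ a.1 ↔ _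
  rw [val_eq_rep]
  exact Germ.coe_le

theorem nonneg_iff {a : GermSpace E} : 0 ≤ a ↔ ∀ᶠ p in denseFilter E, 0 ≤ a.rep p := by
  change (0 : Germ (denseFilter E) E) ≤ a.1 ↔ _
  rw [val_eq_rep]
  exact Germ.coe_le (f := (0 : BandProjection E → E))

theorem inf_eq_zero_iff {a b : GermSpace E} :
    a ⊓ b = 0 ↔ ∀ᶠ p in denseFilter E, (a.rep ⊓ b.rep) p = 0 := by
  refine Subtype.ext_iff.trans ?_
  change a.1 ⊓ b.1 = (0 : Germ (denseFilter E) E) ↔ _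
  rw [val_eq_rep, val_eq_rep]
  exact Germ.coe_eq

instance : IsOrderedModule ℝ (GermSpace E) where
  smul_le_smul_of_nonneg_left r hr a b h := by
    change r • a.1 ≤ r • b.1
    rw [le_iff] at h
    rw [val_eq_rep, val_eq_rep]
    exact Germ.coe_le.2 (by filter_upwards [h] with p hp using smul_le_smul_of_nonneg_left hp hr)
  smul_le_smul_of_nonneg_right a ha r s h := by
    change r • a.1 ≤ s • a.1
    rw [nonneg_iff] at ha
    rw [val_eq_rep]
    exact Germ.coe_le.2 (by filter_upwards [ha] with p hp using smul_le_smul_of_nonneg_right h hp)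

variable (E) in
/-- The constant families embed a vector lattice in its germ space. -/
def const : E →ₗ[ℝ] GermSpace E where
  toFun x := of (fun p => p x) (Eventually.of_forall (isCompatible_apply x))
  map_add' x y := Subtype.ext (Germ.coe_eq.2 (Eventually.of_forall fun p => map_add p.1 x y))
  map_smul' r x := Subtype.ext (Germ.coe_eq.2 (Eventually.of_forall fun p => map_smul p.1 r x))

end GermSpace

end

section

variable {E : Type*} [AddCommGroup E] [ConditionallyCompleteLattice E] [IsOrderedAddMonoid E]
  [Module ℝ E] [IsOrderedModule ℝ E]

/-- What holds eventually holds wherever the family is compatible. Otherwise the band of `(f p)⁻`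
yields a nonzero projection below `p`; shrinking it to a nonzero `s * (P * p)` with `f ≥ 0` there
forces `s (f p)⁻ = 0`, so `s` kills the whole band. -/
theorem IsCompatible.nonneg {f : BandProjection E → E} {p : BandProjection E}
    (hf : IsCompatible f p) (h : ∀ᶠ q in denseFilter E, 0 ≤ f q) : 0 ≤ f p := by
  by_contra hneg
  have hd := negPart_ne_zero_of_not_nonneg hneg
  set P : BandProjection E := ⟨bandProj (f p)⁻, isBandProjection_bandProj _⟩ with hP
  have hPd : P (f p)⁻ = (f p)⁻ := bandProj_self _
  have hpd : p (f p)⁻ = (f p)⁻ := by rw [p.2.map_negPart, hf.apply_self]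
  obtain ⟨s, hs, hst⟩ := eventually_denseFilter.1 h (P * p)
    (ne_zero_of_apply (x := (f p)⁻) (by rwa [mul_apply, hpd, hPd]))
  have h1 := hst 1
  rw [one_mul, ← mul_assoc, hf, ← negPart_eq_zero, ← (s * P).2.map_negPart] at h1
  have h2 : s (f p)⁻ = 0 := by
    rw [← hPd]
    exact h1
  exact hs (eq_zero_of_forall fun x => s.2.apply_bandProj_of_apply_eq_zero h2 (p x))

theorem IsCompatible.le {f g : BandProjection E → E} {p : BandProjection E}
    (hf : IsCompatible f p) (hg : IsCompatible g p)
    (h : ∀ᶠ q in denseFilter E, f q ≤ g q) : f p ≤ g p :=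
  sub_nonneg.1 ((hg.sub hf).nonneg (by filter_upwards [h] with q hq using sub_nonneg.2 hq))

theorem IsCompatible.eq_zero {f : BandProjection E → E} {p : BandProjection E}
    (hf : IsCompatible f p) (h : ∀ᶠ q in denseFilter E, f q = 0) : f p = 0 := by
  have h0 : IsCompatible (0 : BandProjection E → E) p := fun s => by simp
  exact (hf.le h0 (by filter_upwards [h] with q hq using hq.le)).antisymm
    (h0.le hf (by filter_upwards [h] with q hq using hq.ge))

namespace GermSpace

/-- The values of the representatives of a set of germs below a band projection. -/
def values (A : Set (GermSpace E)) (p : BandProjection E) : Set E :=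
  -- For infinite `A` the representatives need not be simultaneously compatible at any `p` of
  -- interest, so each contributes its nonnegative values at those components of `p` where it is
  -- compatible.
  insert 0 {x | ∃ a ∈ A, ∃ s : BandProjection E,
    IsCompatible a.rep (s * p) ∧ 0 ≤ a.rep (s * p) ∧ a.rep (s * p) = x}

theorem values_mul_subset (A : Set (GermSpace E)) (p t : BandProjection E) :
    values A (t * p) ⊆ values A p := by
  rintro x (rfl | ⟨a, ha, s, hs⟩)
  · exact Or.inl rfl
  · rw [← mul_assoc] at hs
    exact Or.inr ⟨a, ha, _, hs⟩

theorem image_values (A : Set (GermSpace E)) (p t : BandProjection E) :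
    t.1 '' values A p = values A (t * p) := by
  ext x
  constructor
  · rintro ⟨_, (rfl | ⟨a, ha, s, hs, hs0, rfl⟩), rfl⟩
    · exact Or.inl (map_zero t.1)
    · have h : s * (t * p) = t * (s * p) := mul_left_comm _ _ _
      refine Or.inr ⟨a, ha, s, ?_, ?_, ?_⟩ <;> rw [h]
      · exact hs.mul t
      · rw [hs]; exact t.2.nonneg _ hs0
      · exact hs t
  · rintro (rfl | ⟨a, ha, s, hs, hs0, rfl⟩)
    · exact ⟨0, Or.inl rfl, map_zero t.1⟩
    · refine ⟨_, Or.inr ⟨a, ha, s * t, ?_, ?_, rfl⟩, ?_⟩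
      · rwa [mul_assoc]
      · rwa [mul_assoc]
      · rw [mul_assoc]
        conv_rhs => rw [← mul_self t, mul_assoc, mul_left_comm s t, hs]

theorem values_le {A : Set (GermSpace E)} {p : BandProjection E} {h : GermSpace E}
    (hp : IsCompatible h.rep p) (h0 : 0 ≤ h) (hA : ∀ a ∈ A, a ≤ h) :
    ∀ x ∈ values A p, x ≤ h.rep p := by
  have hnn : 0 ≤ h.rep p := hp.nonneg (nonneg_iff.1 h0)
  rintro x (rfl | ⟨a, ha, s, hs, hs0, rfl⟩)
  · exact hnn
  · refine (hs.le (hp.mul s) (le_iff.1 (hA a ha))).trans ?_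
    rw [hp s]
    exact s.2.le_self _ hnn

/-- The suprema of the value sets form a compatible family: by `image_values` restriction maps value
sets onto value sets, and band projections are order continuous. -/
theorem exists_isLUB_of_values {A : Set (GermSpace E)} (hne : A.Nonempty) (hA : ∀ a ∈ A, 0 ≤ a)
    (hb : ∀ᶠ p in denseFilter E, BddAbove (values A p)) : ∃ b, IsLUB A b := by
  have hlub : ∀ p, BddAbove (values A p) → IsLUB (values A p) (sSup (values A p)) := fun p hp =>
    isLUB_csSup ⟨0, Or.inl rfl⟩ hp
  have hcompat : ∀ᶠ p in denseFilter E, IsCompatible (fun q => sSup (values A q)) p := by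
    filter_upwards [hb] with p hp s
    refine (hlub _ (hp.mono (values_mul_subset A p s))).unique ?_
    rw [← image_values]
    exact s.2.isLUB_image (hlub p hp)
  refine ⟨of _ hcompat, fun a ha => ?_, fun h hh => ?_⟩
  · rw [le_of_iff]
    filter_upwards [hb, a.eventually_isCompatible_rep, nonneg_iff.1 (hA a ha)] with p hp h1 h2
    exact (hlub p hp).1 (Or.inr ⟨a, ha, 1, by rwa [one_mul], by rwa [one_mul], by rw [one_mul]⟩)
  · obtain ⟨a, ha⟩ := hne
    rw [of_le_iff]
    filter_upwards [hb, h.eventually_isCompatible_rep] with p hp h1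
    exact (hlub p hp).2 (values_le h1 ((hA a ha).trans (hh ha)) hh)

theorem exists_isLUB {A : Set (GermSpace E)} (hne : A.Nonempty) (hA : BddAbove A) :
    ∃ b, IsLUB A b := by
  obtain ⟨a, ha⟩ := hne
  obtain ⟨u, hu⟩ := hA
  -- Passing from `x` to `x ⊔ a - a` makes the set nonnegative without losing its supremum up to
  -- translation.
  obtain ⟨b, hb⟩ := exists_isLUB_of_values (A := (fun x => x ⊔ a - a) '' A) ⟨_, a, ha, rfl⟩
    (by
      rintro _ ⟨x, hx, rfl⟩
      exact sub_nonneg.2 le_sup_right)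
    (by
      filter_upwards [(u - a).eventually_isCompatible_rep] with p hp
      refine ⟨_, values_le hp (sub_nonneg.2 (hu ha)) ?_⟩
      rintro _ ⟨x, hx, rfl⟩
      exact sub_le_sub_right (sup_le (hu hx) (hu ha)) a)
  refine ⟨b + a, fun x hx => ?_, fun w hw => ?_⟩
  · exact le_sup_left.trans (sub_le_iff_le_add.1 (hb.1 ⟨x, hx, rfl⟩))
  · refine le_sub_iff_add_le.1 (hb.2 ?_)
    rintro _ ⟨x, hx, rfl⟩
    exact sub_le_sub_right (sup_le (hw hx) (hw ha)) a

/-- Below `p`, either all values vanish or some `a` has a value `x > 0`. On the band of `x` every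
other member of `D` vanishes, being disjoint from `a`, so `x` bounds the values there. -/
theorem isLaterallyComplete : IsLaterallyComplete (GermSpace E) := by
  intro D hne hD hdisj
  refine exists_isLUB_of_values hne hD (eventually_denseFilter.2 fun p hp => ?_)
  by_cases hz : ∀ x ∈ values D p, x ≤ 0
  · exact ⟨1, by rwa [one_mul], fun t =>
      BddAbove.mono (values_mul_subset D _ t) ⟨0, by rw [one_mul]; exact hz⟩⟩
  push Not at hz
  obtain ⟨x, (rfl | ⟨a, ha, s, hs, hs0, rfl⟩), hx⟩ := hz
  · exact absurd le_rfl hx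
  set x := a.rep (s * p) with hxdef
  have hx0 : x ≠ 0 := fun h => hx h.le
  set P : BandProjection E := ⟨bandProj x, isBandProjection_bandProj _⟩ with hP
  have hPx : P x = x := bandProj_self x
  refine ⟨P * s, ne_zero_of_apply (x := x) ?_, fun t => ⟨x, ?_⟩⟩
  · rw [mul_assoc, mul_apply, hs.apply_self, hPx]
    exact hx0
  rintro _ (rfl | ⟨b, hb, r, hr, hr0, rfl⟩)
  · exact hs0
  have hrw : r * (t * (P * s * p)) = (r * t * P) * (s * p) := by simp only [mul_assoc]
  rw [hrw] at hr hr0 ⊢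
  set ρ := r * t * P with hρ
  rcases eq_or_ne a b with rfl | hab
  · rw [hs]
    exact ρ.2.le_self _ hs0
  · set w := b.rep (ρ * (s * p)) with hw
    have hρw : ρ w = w := by
      rw [hw, ← hr, ← hw, mul_mul_self]
    have hPw : P w = w := by
      rw [hw, ← hr, ← hw]
      congr 1
      rw [hρ, mul_assoc, mul_left_comm, mul_mul_self]
    have h1 : ρ x ⊓ w = 0 := by
      have h2 := ((hs.mul ρ).inf hr).eq_zero (inf_eq_zero_iff.1 (hdisj ha hb hab))
      rw [Pi.inf_apply, hs] at h2
      exact h2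
    have h2 : w ⊓ x = 0 := by
      rw [← ρ.2.eq_self_of_le (le_inf hr0 hs0) inf_le_left hρw, inf_comm, ρ.2.map_inf, hρw, h1]
    rw [← hPw]
    exact (bandProj_of_disjoint hs0 hr0 h2).trans_le hs0

open Classical in
noncomputable instance : ConditionallyCompleteLattice (GermSpace E) :=
  letI : SupSet (GermSpace E) := ⟨fun A => if h : ∃ b, IsLUB A b then h.choose else 0⟩
  conditionallyCompleteLatticeOfLatticeOfsSup (GermSpace E) fun A hA hne => by
    have h := exists_isLUB hne hA
    change IsLUB A (dite _ _ _)
    rw [dif_pos h]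
    exact h.choose_spec

theorem isVLEmbedding_const : IsVLEmbedding (const E) where
  map_sup x y := Subtype.ext (Germ.coe_eq.2 (Eventually.of_forall fun p => p.2.map_sup x y))
  map_inf x y := Subtype.ext (Germ.coe_eq.2 (Eventually.of_forall fun p => p.2.map_inf x y))
  injective := by
    refine (injective_iff_map_eq_zero _).2 fun x hx => ?_
    have h := Germ.coe_eq.1 (Subtype.ext_iff.1 hx)
    exact (isCompatible_apply x 1).eq_zero h

/-- A nonzero value `u.rep p` gives a constant family below `u`, since `q (u.rep p) = u.rep (p * q)
= p (u.rep q) ≤ u.rep q` eventually. -/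
theorem isOrderDense_range_const : IsOrderDense (Set.range (const E)) := by
  intro u hu
  have h : ∃ p, IsCompatible u.rep p ∧ 0 ≤ u.rep p ∧ u.rep p ≠ 0 := by
    by_contra! hcon
    refine hu.not_ge ?_
    change u.1 ≤ (0 : Germ (denseFilter E) E)
    rw [val_eq_rep]
    refine Germ.coe_le.2 ?_
    filter_upwards [u.eventually_isCompatible_rep, nonneg_iff.1 hu.le] with p h1 h2
    exact (hcon p h1 h2).le
  obtain ⟨p, hp, h0, hne⟩ := h
  refine ⟨_, ⟨u.rep p, rfl⟩,
    isVLEmbedding_const.pos_iff.2 (pos_of_nonneg_of_ne h0 hne),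
    (of_le_iff (hf := Eventually.of_forall (isCompatible_apply _))).2 ?_⟩
  filter_upwards [u.eventually_isCompatible_rep, nonneg_iff.1 hu.le] with q hq hq0
  rw [← hp q, mul_comm, hq]
  exact p.2.le_self _ hq0

/-- The germ space is a universal completion. -/
theorem isUniversalCompletion : IsUniversalCompletion E (GermSpace E) :=
  ⟨isLaterallyComplete, const E, isVLEmbedding_const, isOrderDense_range_const⟩

end GermSpace

end

end BandProjection

/-! ### Orthomorphisms and band projections. -/

section Lattices

variable {E : Type*} [AddCommGroup E] [Lattice E] [IsOrderedAddMonoid E] [Module ℝ E]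
  [IsOrderedModule ℝ E]

theorem abs_smul_le_abs_smul (r : ℝ) (x : E) : |r • x| ≤ |r| • |x| := by
  have key : ∀ y : E, r • y ≤ |r| • |y| := by
    intro y
    rcases le_total 0 r with hr | hr
    · rw [abs_of_nonneg hr]
      exact smul_le_smul_of_nonneg_left (le_abs_self y) hr
    · rw [abs_of_nonpos hr, ← neg_smul_neg]
      exact smul_le_smul_of_nonneg_left (neg_le_abs y) (neg_nonneg.2 hr)
  refine abs_le'.2 ⟨key x, ?_⟩
  rw [← smul_neg, ← abs_neg x]
  exact key (-x)

namespace Orth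

theorem neg_toOp (T : Orth E) (x : E) : (-T).toOp x = -T.toOp x := rfl

theorem isArchimedean (hE : IsArchimedean E) : IsArchimedean (Orth E) := by
  intro S T h x hx
  refine hE _ (T.toOp x) fun n => ?_
  have h1 := h n x hx
  rwa [← Nat.cast_smul_eq_nsmul ℝ, toOp_smul, Nat.cast_smul_eq_nsmul] at h1

/-- Operators between `0` and the identity are orthomorphisms. -/
def ofLe (T : E →ₗ[ℝ] E) (h : ∀ x, 0 ≤ x → 0 ≤ T x ∧ T x ≤ x) : Orth E :=
  ⟨T, by
    have mono : ∀ x y : E, x ≤ y → T x ≤ T y := fun x y hxy => by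
      rw [← sub_nonneg, ← map_sub]
      exact (h _ (sub_nonneg.2 hxy)).1
    refine ⟨fun s ⟨a, ha⟩ ⟨b, hb⟩ => ⟨⟨T a, ?_⟩, ⟨T b, ?_⟩⟩, fun B _ x hx => B.solid hx ?_⟩
    · rintro _ ⟨x, hx, rfl⟩
      exact mono _ _ (ha hx)
    · rintro _ ⟨x, hx, rfl⟩
      exact mono _ _ (hb hx)
    · refine le_trans (abs_le'.2 ⟨mono _ _ (le_abs_self x), ?_⟩) (h _ (abs_nonneg x)).2
      rw [← map_neg]
      exact mono _ _ (neg_le_abs x)⟩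

theorem ofLe_toOp {T : E →ₗ[ℝ] E} (h : ∀ x, 0 ≤ x → 0 ≤ T x ∧ T x ≤ x) : (ofLe T h).toOp = T := rfl

end Orth

namespace IsBandProjection

/-- The range of a band projection. -/
def range {p : E →ₗ[ℝ] E} (hp : IsBandProjection p) : VLIdeal E where
  carrier := {x | p x = x}
  zero_mem' := map_zero p
  add_mem' := fun {x y} (hx : p x = x) (hy : p y = y) => show p (x + y) = x + y by
    rw [map_add, hx, hy]
  smul_mem' := fun r x (hx : p x = x) => show p (r • x) = r • x by rw [map_smul, hx]
  solid := by
    intro x (hx : p x = x) y hyx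
    have h1 : p |y| = |y| := hp.eq_self_of_le (abs_nonneg y) hyx (by rw [hp.map_abs, hx])
    have h2 := hp.eq_self_of_le (posPart_nonneg y) (sup_le (le_abs_self y) (abs_nonneg y)) h1
    have h3 := hp.eq_self_of_le (negPart_nonneg y) (sup_le (neg_le_abs y) (abs_nonneg y)) h1
    change p y = y
    rw [← posPart_sub_negPart y, map_sub, h2, h3]

theorem isBand_range {p : E →ₗ[ℝ] E} (hp : IsBandProjection p) : hp.range.IsBand := by
  intro D x hD hx
  have h := hp.isLUB_image hx
  have h1 : p '' D = D := by
    conv_rhs => rw [← Set.image_id D]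
    exact Set.image_congr fun a ha => hD ha
  rw [h1] at h
  exact h.unique hx

/-- The ranges of `p` and of its complement are bands, so `T` leaves both invariant. -/
theorem commute_orth {p : E →ₗ[ℝ] E} (hp : IsBandProjection p) (T : Orth E) (x : E) :
    T.toOp (p x) = p (T.toOp x) := by
  have h1 : p (T.toOp (p x)) = T.toOp (p x) := T.2.2 _ hp.isBand_range (p x) (hp.idem x)
  have h2 := T.2.2 _ hp.compl.isBand_range _ (hp.compl.idem x)
  change (LinearMap.id - p : E →ₗ[ℝ] E) (T.toOp ((LinearMap.id - p : E →ₗ[ℝ] E) x)) =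
    T.toOp ((LinearMap.id - p : E →ₗ[ℝ] E) x) at h2
  simp only [LinearMap.sub_apply, LinearMap.id_apply, map_sub, h1] at h2
  rw [sub_self, sub_zero] at h2
  exact (sub_right_injective h2).symm

end IsBandProjection

end Lattices

/-! ### Dyadic expansions with band projections as digits. -/

section Dyadic

variable {E : Type*} [AddCommGroup E] [ConditionallyCompleteLattice E] [IsOrderedAddMonoid E]
  [Module ℝ E] [IsOrderedModule ℝ E]

/-- The doubling map of binary expansion, done bandwise: the digit is `1` on the band where `2 y`
exceeds `e`, and `0` on its complement, where `2 y ≤ e`. -/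
theorem dyadic_step {e y : E} (h0 : 0 ≤ y) (h1 : y ≤ e) :
    0 ≤ (2 : ℝ) • y - bandProj ((2 : ℝ) • y - e)⁺ e ∧
      (2 : ℝ) • y - bandProj ((2 : ℝ) • y - e)⁺ e ≤ e := by
  set z := (2 : ℝ) • y - e with hz
  set P := bandProj z⁺ with hP
  have hp : IsBandProjection P := isBandProjection_bandProj _
  have h2 : P z = z⁺ := bandProj_posPart_apply z
  have h3 : P z = (2 : ℝ) • P y - P e := by rw [hz, map_sub, map_smul]
  constructor
  · have h4 : (2 : ℝ) • y - P e = (2 : ℝ) • (y - P y) + z⁺ := by rw [← h2, h3]; module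
    rw [h4]
    exact add_nonneg (smul_nonneg (by norm_num) (sub_nonneg.2 (hp.le_self _ h0)))
      (posPart_nonneg z)
  · have h4 : e - ((2 : ℝ) • y - P e) = z⁻ + (2 : ℝ) • (P e - P y) := by
      have h5 : z⁻ = z⁺ - z := by
        rw [eq_sub_iff_add_eq, ← eq_sub_iff_add_eq', posPart_sub_negPart]
      rw [h5, ← h2, h3, hz]; module
    rw [← sub_nonneg, h4]
    exact add_nonneg (negPart_nonneg z) (smul_nonneg (by norm_num) (sub_nonneg.2 (hp.mono h1)))

/-- Dyadic expansion of an element of the order interval `[0, e]` with band components of `e` as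
digits. -/
theorem exists_dyadic_expansion {e x : E} (h0 : 0 ≤ x) (h1 : x ≤ e) :
    ∃ (p : ℕ → E →ₗ[ℝ] E) (r : ℕ → E), (∀ n, IsBandProjection (p n)) ∧
      (∀ n, 0 ≤ r n ∧ r n ≤ e) ∧
      ∀ n, x = ∑ k ∈ Finset.range n, (1 / 2 : ℝ) ^ (k + 1) • p k e + (1 / 2 : ℝ) ^ n • r n := by
  let r : ℕ → E := fun n =>
    Nat.rec x (fun _ y => (2 : ℝ) • y - bandProj ((2 : ℝ) • y - e)⁺ e) n
  have hr : ∀ n, r (n + 1) = (2 : ℝ) • r n - bandProj ((2 : ℝ) • r n - e)⁺ e := fun _ => rfl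
  refine ⟨fun n => bandProj ((2 : ℝ) • r n - e)⁺, r, fun n => isBandProjection_bandProj _,
    fun n => ?_, fun n => ?_⟩
  · induction n with
    | zero => exact ⟨h0, h1⟩
    | succ n ih => exact dyadic_step ih.1 ih.2
  · induction n with
    | zero => simp [r]
    | succ n ih =>
      rw [Finset.sum_range_succ, hr]
      conv_lhs => rw [ih]
      module

theorem nsmul_half_pow_smul_le {b : E} (hb : 0 ≤ b) (n : ℕ) : n • ((1 / 2 : ℝ) ^ n • b) ≤ b := by
  rw [← Nat.cast_smul_eq_nsmul ℝ, smul_smul]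
  conv_rhs => rw [← one_smul ℝ b]
  refine smul_le_smul_of_nonneg_right ?_ hb
  have h : (n : ℝ) ≤ 2 ^ n := by exact_mod_cast Nat.lt_two_pow_self.le
  rw [one_div, inv_pow, ← div_eq_mul_inv]
  exact div_le_one_of_le₀ h (by positivity)

theorem nonneg_of_neg_half_pow_le {a b : E} (hb : 0 ≤ b)
    (h : ∀ n : ℕ, -((1 / 2 : ℝ) ^ n • b) ≤ a) : 0 ≤ a := by
  rw [← neg_nonpos]
  refine isArchimedean_of_conditionallyComplete E _ b fun n => ?_
  exact (nsmul_le_nsmul_right (neg_le.1 (h n)) n).trans (nsmul_half_pow_smul_le hb n)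

/-- Every element of `[0, e]` is the image of `e` under an orthomorphism in `[0, 1]`. -/
theorem exists_operator_apply_eq {e x : E} (h0 : 0 ≤ x) (h1 : x ≤ e) :
    ∃ T : E →ₗ[ℝ] E, (∀ y, 0 ≤ y → 0 ≤ T y ∧ T y ≤ y) ∧ T e = x := by
  obtain ⟨p, r, hp, hr, hx⟩ := exists_dyadic_expansion h0 h1
  set s : ℕ → E → E := fun n y => ∑ k ∈ Finset.range n, (1 / 2 : ℝ) ^ (k + 1) • p k y with hs
  have hterm : ∀ k y, 0 ≤ y → 0 ≤ (1 / 2 : ℝ) ^ (k + 1) • p k y := fun k y hy =>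
    smul_nonneg (by positivity) ((hp k).nonneg y hy)
  have hsmono : ∀ y, 0 ≤ y → Monotone fun n => s n y := fun y hy =>
    monotone_nat_of_le_succ fun n => by
      simp only [hs, Finset.sum_range_succ]
      exact le_add_of_nonneg_right (hterm n y hy)
  -- The weights of `s n` add up to `1 - 2⁻ⁿ`; keeping the remaining `2⁻ⁿ` in the claim makes the
  -- induction close.
  have hsle : ∀ n y, 0 ≤ y → s n y + (1 / 2 : ℝ) ^ n • y ≤ y := by
    intro n y hy
    induction n with
    | zero => simp [hs]
    | succ n ih =>
      refine le_trans ?_ ih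
      simp only [hs, Finset.sum_range_succ]
      have h2 : (1 / 2 : ℝ) ^ n • y = (1 / 2 : ℝ) ^ (n + 1) • y + (1 / 2 : ℝ) ^ (n + 1) • y := by
        module
      rw [h2, add_assoc]
      exact add_le_add_right (add_le_add_left
        (smul_le_smul_of_nonneg_left ((hp n).le_self y hy) (by positivity)) _) _
  have hsle' : ∀ n y, 0 ≤ y → s n y ≤ y := fun n y hy =>
    (le_add_of_nonneg_right (smul_nonneg (by positivity) hy)).trans (hsle n y hy)
  have hlub : ∀ y, 0 ≤ y → IsLUB (Set.range fun n => s n y) (sSup (Set.range fun n => s n y)) :=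
    fun y hy => isLUB_csSup (Set.range_nonempty _) ⟨y, by rintro _ ⟨n, rfl⟩; exact hsle' n y hy⟩
  have hsadd : ∀ n y z, s n (y + z) = s n y + s n z := fun n y z => by
    simp only [hs, map_add, smul_add, Finset.sum_add_distrib]
  obtain ⟨T, hT⟩ := exists_linear_extension (isArchimedean_of_conditionallyComplete E)
    (f := fun y => sSup (Set.range fun n => s n y)) (fun y z hy hz => by
      refine (hlub _ (add_nonneg hy hz)).unique ⟨?_, fun w hw => ?_⟩
      · rintro _ ⟨n, rfl⟩
        simp only [hsadd]
        exact add_le_add ((hlub y hy).1 ⟨n, rfl⟩) ((hlub z hz).1 ⟨n, rfl⟩)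
      · refine ((hlub y hy).add (hlub z hz)).2 ?_
        rintro _ ⟨_, ⟨n, rfl⟩, _, ⟨m, rfl⟩, rfl⟩
        refine le_trans ?_ (hw ⟨max n m, rfl⟩)
        simp only [hsadd]
        exact add_le_add (hsmono y hy (le_max_left n m)) (hsmono z hz (le_max_right n m)))
    (fun y hy => (hlub y hy).1 ⟨0, by simp [hs]⟩)
  refine ⟨T, fun y hy => ?_, ?_⟩
  · rw [hT y hy]
    refine ⟨(hlub y hy).1 ⟨0, by simp [hs]⟩, (hlub y hy).2 ?_⟩
    rintro _ ⟨n, rfl⟩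
    exact hsle' n y hy
  · have he : 0 ≤ e := h0.trans h1
    rw [hT e he]
    refine (hlub e he).unique ⟨?_, fun w hw => ?_⟩
    · rintro _ ⟨n, rfl⟩
      conv_rhs => rw [hx n]
      exact le_add_of_nonneg_right (smul_nonneg (by positivity) (hr n).1)
    · rw [← sub_nonneg]
      refine nonneg_of_neg_half_pow_le he fun n => ?_
      have h2 : s n e ≤ w := hw ⟨n, rfl⟩
      have h3 : x ≤ s n e + (1 / 2 : ℝ) ^ n • e := by
        conv_lhs => rw [hx n]
        exact add_le_add_right (smul_le_smul_of_nonneg_left (hr n).2 (by positivity)) _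
      rw [neg_le, neg_sub, sub_le_iff_le_add']
      exact h3.trans (add_le_add_left h2 _)

namespace Orth

/-- An orthomorphism that is positive at `e` is positive on `[0, e]`. -/
theorem apply_nonneg_of_le (T : Orth E) {e y : E} (he : 0 ≤ T.toOp e) (h0 : 0 ≤ y) (h1 : y ≤ e) :
    0 ≤ T.toOp y := by
  obtain ⟨p, r, hp, hr, hy⟩ := exists_dyadic_expansion h0 h1
  -- Order boundedness replaces order continuity of `T`: a lower bound `b` of `T` on `[0, e]`
  -- controls the remainder by `2⁻ⁿ • b`.
  obtain ⟨⟨b, hb⟩, -⟩ := T.2.1 (Set.Icc 0 e) bddBelow_Icc bddAbove_Icc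
  have hb0 : b ≤ 0 := by
    have h := hb ⟨0, ⟨le_rfl, h0.trans h1⟩, rfl⟩
    rwa [map_zero] at h
  refine nonneg_of_neg_half_pow_le (neg_nonneg.2 hb0) fun n => ?_
  rw [hy n, map_add, map_sum, map_smul, smul_neg, neg_neg]
  have h2 : 0 ≤ ∑ k ∈ Finset.range n, T.toOp ((1 / 2 : ℝ) ^ (k + 1) • p k e) :=
    Finset.sum_nonneg fun k _ => by
      rw [map_smul, (hp k).commute_orth]
      exact smul_nonneg (by positivity) ((hp k).nonneg _ he)
  have h3 : b ≤ T.toOp (r n) := hb ⟨r n, hr n, rfl⟩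
  exact (smul_le_smul_of_nonneg_left h3 (by positivity)).trans (le_add_of_nonneg_left h2)

end Orth

end Dyadic

/-! ### Multiplication operators attached to a maximal disjoint system. -/

/-- A maximal disjoint system. -/
structure IsMaximalDisjoint {E : Type*} [AddCommGroup E] [Lattice E] (S : Set E) : Prop where
  pos : ∀ e ∈ S, 0 < e
  disjoint : S.Pairwise fun x y => x ⊓ y = 0
  exists_inf_ne_zero : ∀ x : E, 0 < x → ∃ e ∈ S, e ⊓ x ≠ 0

theorem exists_isMaximalDisjoint (E : Type*) [AddCommGroup E] [Lattice E] :
    ∃ S : Set E, IsMaximalDisjoint S := by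
  obtain ⟨S, h1, h2, h3⟩ := exists_maximal_disjoint (fun x : E => 0 < x) (fun _ h => h)
  exact ⟨S, h1, h2, h3⟩

namespace IsMaximalDisjoint

variable {E : Type*} [AddCommGroup E] [ConditionallyCompleteLattice E] [IsOrderedAddMonoid E]
  [Module ℝ E] [IsOrderedModule ℝ E] {S : Set E}

theorem bandProj_of_ne (hS : IsMaximalDisjoint S) {d e : E} (hd : d ∈ S) (he : e ∈ S)
    (hne : d ≠ e) : bandProj d e = 0 :=
  bandProj_of_disjoint (hS.pos d hd).le (hS.pos e he).le (hS.disjoint he hd hne.symm)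

theorem inf_le_bandProj (hS : IsMaximalDisjoint S) {e x : E} (he : e ∈ S) (hx : 0 ≤ x) :
    e ⊓ x ≤ bandProj e x := by
  rw [← bandProj_of_le (le_inf (hS.pos e he).le hx) inf_le_left]
  exact (isBandProjection_bandProj e).mono inf_le_right

theorem nonneg_of_bandProj (hS : IsMaximalDisjoint S) {x : E}
    (h : ∀ e ∈ S, 0 ≤ bandProj e x) : 0 ≤ x := by
  by_contra hx
  obtain ⟨e, he, hne⟩ := hS.exists_inf_ne_zero x⁻
    (pos_of_nonneg_of_ne (negPart_nonneg x) (negPart_ne_zero_of_not_nonneg hx))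
  refine hne (le_antisymm ((hS.inf_le_bandProj he (negPart_nonneg x)).trans_eq ?_)
    (le_inf (hS.pos e he).le (negPart_nonneg x)))
  rw [(isBandProjection_bandProj e).map_negPart, negPart_eq_zero.2 (h e he)]

/-- Let `Q` project onto the part where `y ≤ n • e`. There `T y ≥ 0` by `apply_nonneg_of_le`, so `(T
y)⁻` has no component in it. Hence `e ⊓ (T y)⁻` lives where `n • e ≤ y`, and its `n`-fold stays
below `y` for every `n`. -/
theorem orth_nonneg (hS : IsMaximalDisjoint S) {T : Orth E} (hT : ∀ e ∈ S, 0 ≤ T.toOp e) :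
    0 ≤ T := by
  intro y hy
  rw [Orth.toOp_zero]
  by_contra hneg
  set d := (T.toOp y)⁻ with hd
  have hd0 : 0 ≤ d := negPart_nonneg _
  obtain ⟨e, he, hne⟩ := hS.exists_inf_ne_zero d
    (pos_of_nonneg_of_ne hd0 (negPart_ne_zero_of_not_nonneg hneg))
  have hm0 : 0 ≤ e ⊓ d := le_inf (hS.pos e he).le hd0
  refine hne (le_antisymm (isArchimedean_of_conditionallyComplete E _ y fun n => ?_) hm0)
  set z := y - n • e with hz
  have hR : IsBandProjection (bandProj z⁺) := isBandProjection_bandProj _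
  have hRz : bandProj z⁺ z = z⁺ := bandProj_posPart_apply z
  set Q := LinearMap.id - bandProj z⁺ with hQ
  have hQp : IsBandProjection Q := hR.compl
  have hQz : Q z ≤ 0 := by
    rw [hQ, LinearMap.sub_apply, LinearMap.id_apply, hRz, sub_nonpos]
    exact le_posPart z
  have hQy : Q y ≤ n • Q e := by
    rwa [hz, map_sub, map_nsmul, sub_nonpos] at hQz
  have hTQ : 0 ≤ T.toOp (Q y) := by
    refine T.apply_nonneg_of_le ?_ (hQp.nonneg y hy) hQy
    rw [map_nsmul, hQp.commute_orth]
    exact nsmul_nonneg (hQp.nonneg _ (hT e he)) n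
  have hQd : Q d = 0 := by
    rw [hd, hQp.map_negPart, ← hQp.commute_orth, negPart_eq_zero.2 hTQ]
  have hQm : Q (e ⊓ d) = 0 := hQp.eq_zero_of_le hm0 inf_le_right hQd
  have hRm : e ⊓ d = bandProj z⁺ (e ⊓ d) := by
    rwa [hQ, LinearMap.sub_apply, LinearMap.id_apply, sub_eq_zero] at hQm
  calc n • (e ⊓ d) = n • bandProj z⁺ (e ⊓ d) := by rw [← hRm]
    _ ≤ n • bandProj z⁺ e := nsmul_le_nsmul_right (hR.mono inf_le_left) n
    _ ≤ bandProj z⁺ y := by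
      rw [← sub_nonneg, ← map_nsmul, ← map_sub, hRz]
      exact posPart_nonneg z
    _ ≤ y := hR.le_self y hy

theorem orth_le (hS : IsMaximalDisjoint S) {T T' : Orth E}
    (h : ∀ e ∈ S, T.toOp e ≤ T'.toOp e) : T ≤ T' :=
  sub_nonneg.1 (hS.orth_nonneg fun e he => by
    rw [Orth.toOp_sub]
    exact sub_nonneg.2 (h e he))

theorem orth_ext (hS : IsMaximalDisjoint S) {T T' : Orth E}
    (h : ∀ e ∈ S, T.toOp e = T'.toOp e) : T = T' :=
  (hS.orth_le fun e he => (h e he).le).antisymm (hS.orth_le fun e he => (h e he).ge)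

theorem sum_nonneg (hS : IsMaximalDisjoint S) {F : Finset E} (hF : ↑F ⊆ S) : 0 ≤ ∑ e ∈ F, e :=
  Finset.sum_nonneg fun e he => (hS.pos e (hF he)).le

theorem sum_mono (hS : IsMaximalDisjoint S) {F F' : Finset E} (hF : F ⊆ F') (hF' : ↑F' ⊆ S) :
    ∑ e ∈ F, e ≤ ∑ e ∈ F', e :=
  Finset.sum_le_sum_of_subset_of_nonneg hF fun e he _ => (hS.pos e (hF' he)).le

theorem bandProj_sum (hS : IsMaximalDisjoint S) {F : Finset E} (hF : ↑F ⊆ S) {e : E} (he : e ∈ F) :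
    bandProj e (∑ d ∈ F, d) = e := by
  rw [map_sum, Finset.sum_eq_single e (fun d hd hde => hS.bandProj_of_ne (hF he) (hF hd) hde.symm)
    (fun h => absurd he h), bandProj_self]

theorem bandProj_sum_of_notMem (hS : IsMaximalDisjoint S) {F : Finset E} (hF : ↑F ⊆ S) {e : E}
    (heS : e ∈ S) (he : e ∉ F) : bandProj e (∑ d ∈ F, d) = 0 := by
  rw [map_sum]
  exact Finset.sum_eq_zero fun d hd =>
    hS.bandProj_of_ne heS (hF hd) (fun h => he (h ▸ hd))

open Classical in
/-- The ideal generated by a maximal disjoint system. -/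
def ideal (hS : IsMaximalDisjoint S) : VLIdeal E where
  carrier := {x | ∃ F : Finset E, ↑F ⊆ S ∧ ∃ n : ℕ, |x| ≤ n • ∑ e ∈ F, e}
  zero_mem' := ⟨∅, by simp, 0, by simp⟩
  add_mem' := by
    rintro x y ⟨F, hF, n, hn⟩ ⟨F', hF', m, hm⟩
    have hFF : (↑(F ∪ F') : Set E) ⊆ S := by
      rw [Finset.coe_union]; exact Set.union_subset hF hF'
    refine ⟨F ∪ F', hFF, n + m, (abs_add_le x y).trans ?_⟩
    rw [add_nsmul]
    exact add_le_add
      (hn.trans (nsmul_le_nsmul_right (hS.sum_mono Finset.subset_union_left hFF) n))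
      (hm.trans (nsmul_le_nsmul_right (hS.sum_mono Finset.subset_union_right hFF) m))
  smul_mem' := by
    rintro r x ⟨F, hF, n, hn⟩
    obtain ⟨N, hN⟩ := exists_nat_ge |r|
    refine ⟨F, hF, N * n, (abs_smul_le_abs_smul r x).trans ?_⟩
    refine (smul_le_smul_of_nonneg_right hN (abs_nonneg x)).trans ?_
    rw [Nat.cast_smul_eq_nsmul, mul_nsmul']
    exact nsmul_le_nsmul_right hn N
  solid := by
    rintro x ⟨F, hF, n, hn⟩ y hyx
    exact ⟨F, hF, n, hyx.trans hn⟩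

theorem mem_ideal (hS : IsMaximalDisjoint S) {x : E} : x ∈ hS.ideal.toSubmodule ↔
    ∃ F : Finset E, ↑F ⊆ S ∧ ∃ n : ℕ, |x| ≤ n • ∑ e ∈ F, e := Iff.rfl

theorem mem_ideal_of_le (hS : IsMaximalDisjoint S) {e x : E} (he : e ∈ S) (h0 : 0 ≤ x)
    (hx : x ≤ e) : x ∈ hS.ideal.toSubmodule :=
  hS.mem_ideal.2 ⟨{e}, by simpa using he, 1, by simpa [abs_of_nonneg h0] using hx⟩

theorem isOrderDense_ideal (hS : IsMaximalDisjoint S) : IsOrderDense hS.ideal.carrier := by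
  intro x hx
  obtain ⟨e, he, hne⟩ := hS.exists_inf_ne_zero x hx
  have h0 : 0 ≤ e ⊓ x := le_inf (hS.pos e he).le hx.le
  exact ⟨e ⊓ x, hS.mem_ideal_of_le he h0 inf_le_left, pos_of_nonneg_of_ne h0 hne, inf_le_right⟩

theorem exists_orth_of_nonneg (hS : IsMaximalDisjoint S) {x : E} (h0 : 0 ≤ x)
    (hx : x ∈ hS.ideal.toSubmodule) : ∃ T : Orth E, ∀ e ∈ S, T.toOp e = bandProj e x := by
  obtain ⟨F, hF, n, hn⟩ := hx
  rw [abs_of_nonneg h0] at hn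
  set s := ∑ e ∈ F, e with hs
  have hs0 : 0 ≤ s := hS.sum_nonneg hF
  obtain ⟨T, hT, hTx⟩ := exists_operator_apply_eq h0 hn
  have hp := isBandProjection_bandProj s
  set T' : Orth E := Orth.ofLe T hT
  -- `T` maps `n • s` to `x`, so `n • T` acts correctly on `F`; composing with the projection onto
  -- the band of `s` kills the members of `S` outside `F`.
  refine ⟨(n : ℝ) • Orth.ofLe (T ∘ₗ bandProj s) fun y hy =>
    ⟨(hT _ (hp.nonneg y hy)).1, (hT _ (hp.nonneg y hy)).2.trans (hp.le_self y hy)⟩,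
    fun e he => ?_⟩
  rw [Orth.toOp_smul, Orth.ofLe_toOp, LinearMap.comp_apply, Nat.cast_smul_eq_nsmul]
  have hpe := isBandProjection_bandProj e
  by_cases heF : e ∈ F
  · have hes : e ≤ s := Finset.single_le_sum (f := fun d => d)
      (fun d hd => (hS.pos d (hF hd)).le) heF
    rw [bandProj_of_le (hS.pos e he).le hes, ← map_nsmul]
    have h1 := hpe.commute_orth T' (n • s)
    change T _ = bandProj e (T _) at h1
    rwa [hTx, map_nsmul, hs, hS.bandProj_sum hF heF] at h1
  · have h1 : bandProj e s = 0 := hS.bandProj_sum_of_notMem hF he heF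
    have h2 : e ⊓ s = 0 := le_antisymm ((hS.inf_le_bandProj he hs0).trans_eq h1)
      (le_inf (hS.pos e he).le hs0)
    rw [bandProj_of_disjoint hs0 (hS.pos e he).le h2, map_zero, smul_zero]
    exact (hpe.eq_zero_of_le h0 hn (by rw [map_nsmul, h1, smul_zero])).symm

theorem exists_orth (hS : IsMaximalDisjoint S) (x : hS.ideal.toSubmodule) :
    ∃ T : Orth E, ∀ e ∈ S, T.toOp e = bandProj e x := by
  obtain ⟨T, hT⟩ := hS.exists_orth_of_nonneg (posPart_nonneg (x : E))
    (hS.ideal.solid x.2 (by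
      rw [abs_of_nonneg (posPart_nonneg _)]; exact sup_le (le_abs_self _) (abs_nonneg _)))
  obtain ⟨T', hT'⟩ := hS.exists_orth_of_nonneg (negPart_nonneg (x : E))
    (hS.ideal.solid x.2 (by
      rw [abs_of_nonneg (negPart_nonneg _)]; exact sup_le (neg_le_abs _) (abs_nonneg _)))
  refine ⟨T - T', fun e he => ?_⟩
  rw [Orth.toOp_sub, hT e he, hT' e he, ← map_sub, posPart_sub_negPart]

/-- Multiplication by the elements of the ideal generated by a maximal disjoint system, in which
that system serves as a unit. -/
noncomputable def multiplication (hS : IsMaximalDisjoint S) :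
    hS.ideal.toSubmodule →ₗ[ℝ] Orth E where
  toFun x := (hS.exists_orth x).choose
  map_add' x y := hS.orth_ext fun e he => by
    rw [Orth.toOp_add, (hS.exists_orth _).choose_spec e he, (hS.exists_orth _).choose_spec e he,
      (hS.exists_orth _).choose_spec e he, Submodule.coe_add, map_add]
  map_smul' r x := hS.orth_ext fun e he => by
    rw [RingHom.id_apply, Orth.toOp_smul, (hS.exists_orth _).choose_spec e he,
      (hS.exists_orth _).choose_spec e he, Submodule.coe_smul, map_smul]

theorem multiplication_apply (hS : IsMaximalDisjoint S) (x : hS.ideal.toSubmodule) {e : E}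
    (he : e ∈ S) : (hS.multiplication x).toOp e = bandProj e x :=
  (hS.exists_orth x).choose_spec e he

theorem multiplication_nonneg_iff (hS : IsMaximalDisjoint S) {x : hS.ideal.toSubmodule} :
    0 ≤ hS.multiplication x ↔ 0 ≤ (x : E) := by
  refine ⟨fun h => hS.nonneg_of_bandProj fun e he => ?_, fun h => hS.orth_nonneg fun e he => ?_⟩
  · rw [← hS.multiplication_apply x he]
    exact h e (hS.pos e he).le
  · rw [hS.multiplication_apply x he]
    exact (isBandProjection_bandProj e).nonneg _ h

theorem multiplication_injective (hS : IsMaximalDisjoint S) :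
    Function.Injective hS.multiplication := by
  refine (injective_iff_map_eq_zero _).2 fun x hx => Subtype.ext (le_antisymm ?_ ?_)
  · exact neg_nonneg.1 ((hS.multiplication_nonneg_iff (x := -x)).1 (by rw [map_neg, hx, neg_zero]))
  · exact hS.multiplication_nonneg_iff.1 hx.ge

theorem multiplication_mono (hS : IsMaximalDisjoint S) {x y : hS.ideal.toSubmodule}
    (h : (x : E) ≤ y) : hS.multiplication x ≤ hS.multiplication y := by
  rw [← sub_nonneg, ← map_sub, hS.multiplication_nonneg_iff]
  exact sub_nonneg.2 h

/-- The ideal of orthomorphisms given by multiplication. -/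
noncomputable def orthIdeal (hS : IsMaximalDisjoint S) : VLIdeal (Orth E) where
  toSubmodule := LinearMap.range hS.multiplication
  solid := by
    rintro _ ⟨x, rfl⟩ T hT
    obtain ⟨F, hF, n, hn⟩ := x.2
    have habs : |(x : E)| ∈ hS.ideal.toSubmodule := hS.ideal.solid x.2 (by rw [abs_abs])
    set R := hS.multiplication ⟨|(x : E)|, habs⟩ with hRdef
    have hTR : |T| ≤ R := hT.trans (abs_le'.2
      ⟨hS.multiplication_mono (le_abs_self (x : E)), by
        rw [← map_neg]; exact hS.multiplication_mono (neg_le_abs (x : E))⟩)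
    have hle : ∀ y, 0 ≤ y → |T.toOp y| ≤ R.toOp y := fun y hy => abs_le'.2
      ⟨((le_abs_self T).trans hTR) y hy, by
        rw [← Orth.neg_toOp]; exact ((neg_le_abs T).trans hTR) y hy⟩
    set s := ∑ e ∈ F, e with hs
    have hRs : R.toOp s ≤ n • s := by
      rw [hs, map_sum, Finset.smul_sum]
      refine Finset.sum_le_sum fun e he => ?_
      rw [hRdef, hS.multiplication_apply _ (hF he)]
      refine ((isBandProjection_bandProj e).mono hn).trans_eq ?_
      rw [map_nsmul, hs, hS.bandProj_sum hF he]
    -- The multiplier is `T s`: its component at `e ∈ F` is `T (bandProj e s) = T e`, and for `e ∉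
    -- F` both sides vanish because `R` does.
    refine ⟨⟨T.toOp s, F, hF, n, (hle s (hS.sum_nonneg hF)).trans hRs⟩,
      hS.orth_ext fun e he => ?_⟩
    have hpe := isBandProjection_bandProj e
    rw [hS.multiplication_apply _ he, ← hpe.commute_orth]
    by_cases heF : e ∈ F
    · rw [hs, hS.bandProj_sum hF heF]
    · have h1 := hle e (hS.pos e he).le
      rw [hRdef, hS.multiplication_apply _ he, hpe.eq_zero_of_le (abs_nonneg _) hn
        (by rw [map_nsmul, hs, hS.bandProj_sum_of_notMem hF he heF, smul_zero])] at h1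
      rw [hs, hS.bandProj_sum_of_notMem hF he heF, map_zero]
      have h2 := abs_le'.1 h1
      exact (neg_nonpos.1 h2.2).antisymm h2.1

/-- Multiplication by `T e ⊓ e` is at most `T` at `e` and vanishes on the rest of `S`. It is nonzero
when `T e` is, since `T e` lies in the band of `e`. -/
theorem isOrderDense_orthIdeal (hS : IsMaximalDisjoint S) : IsOrderDense hS.orthIdeal.carrier := by
  intro T hT
  have h : ∃ e ∈ S, T.toOp e ≠ 0 := by
    by_contra! hcon
    exact hT.ne' (hS.orth_ext fun e he => by rw [hcon e he, Orth.toOp_zero])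
  obtain ⟨e, he, hne⟩ := h
  have he0 := (hS.pos e he).le
  have hTe : 0 ≤ T.toOp e := hT.le e he0
  have hpe := isBandProjection_bandProj e
  have hx0 : 0 ≤ T.toOp e ⊓ e := le_inf hTe he0
  have hx : 0 < T.toOp e ⊓ e := pos_of_nonneg_of_ne hx0 fun h => hne (by
    have h1 := hpe.commute_orth T e
    rwa [bandProj_self, bandProj_of_disjoint he0 hTe h] at h1)
  set x : hS.ideal.toSubmodule := ⟨T.toOp e ⊓ e, hS.mem_ideal_of_le he hx0 inf_le_right⟩ with hxdef
  have hMx : 0 ≤ hS.multiplication x := hS.multiplication_nonneg_iff.2 hx0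
  refine ⟨hS.multiplication x, ⟨x, rfl⟩, pos_of_nonneg_of_ne hMx fun h => ?_,
    hS.orth_le fun d hd => ?_⟩
  · have h1 : x = 0 := hS.multiplication_injective (by rw [h, map_zero])
    exact hx.ne' (congrArg Subtype.val h1)
  · rw [hS.multiplication_apply x hd]
    rcases eq_or_ne d e with rfl | hde
    · rw [bandProj_of_le hx0 inf_le_right]
      exact inf_le_left
    · rw [(isBandProjection_bandProj d).eq_zero_of_le hx0 (y := e) inf_le_right
        (hS.bandProj_of_ne hd he hde)]
      exact hT.le d (hS.pos d hd).le

end IsMaximalDisjoint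

/-! ### Transfer to universal completions and the main theorem. -/

section Transfer

theorem exists_vlEquiv_of_nonneg_iff {G H : Type*} [AddCommGroup G] [Lattice G]
    [IsOrderedAddMonoid G] [Module ℝ G] [AddCommGroup H] [Lattice H] [IsOrderedAddMonoid H]
    [Module ℝ H] (f : G ≃ₗ[ℝ] H) (hf : ∀ x, 0 ≤ f x ↔ 0 ≤ x) :
    ∃ g : VLEquiv G H, g.toLinearEquiv = f := by
  have hle : ∀ {x y}, f x ≤ f y ↔ x ≤ y := fun {x y} => by
    rw [← sub_nonneg, ← map_sub, hf, sub_nonneg]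
  let o : G ≃o H := { f.toEquiv with map_rel_iff' := hle }
  exact ⟨{ f with map_sup' := o.map_sup, map_inf' := o.map_inf }, rfl⟩

theorem IsVLEmbedding.comp {E F G : Type*} [AddCommGroup E] [Lattice E] [Module ℝ E]
    [AddCommGroup F] [Lattice F] [Module ℝ F] [AddCommGroup G] [Lattice G] [Module ℝ G]
    {i : E →ₗ[ℝ] F} {j : F →ₗ[ℝ] G} (hj : IsVLEmbedding j) (hi : IsVLEmbedding i) :
    IsVLEmbedding (j ∘ₗ i) where
  map_sup x y := by simp only [LinearMap.comp_apply, hi.map_sup, hj.map_sup]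
  map_inf x y := by simp only [LinearMap.comp_apply, hi.map_inf, hj.map_inf]
  injective := hj.injective.comp hi.injective

theorem IsOrderDense.range_comp {E F G : Type*} [AddCommGroup E] [Lattice E] [Module ℝ E]
    [AddCommGroup F] [Lattice F] [IsOrderedAddMonoid F] [Module ℝ F] [IsOrderedModule ℝ F]
    [AddCommGroup G] [Lattice G] [IsOrderedAddMonoid G] [Module ℝ G] [IsOrderedModule ℝ G]
    {i : E →ₗ[ℝ] F} {j : F →ₗ[ℝ] G} (hj : IsVLEmbedding j) (hjd : IsOrderDense (Set.range j))
    (hid : IsOrderDense (Set.range i)) : IsOrderDense (Set.range (j ∘ₗ i)) := by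
  intro x hx
  obtain ⟨_, ⟨y, rfl⟩, hy0, hyx⟩ := hjd x hx
  obtain ⟨_, ⟨z, rfl⟩, hz0, hzy⟩ := hid y (hj.pos_iff.1 hy0)
  exact ⟨_, ⟨z, rfl⟩, hj.pos_iff.2 hz0, (hj.le_iff.2 hzy).trans hyx⟩

variable {E : Type*} [AddCommGroup E] [Lattice E] [IsOrderedAddMonoid E] [Module ℝ E]
  [IsOrderedModule ℝ E]

namespace VLIdeal

instance (I : VLIdeal E) : IsOrderedModule ℝ I.toSubmodule where
  smul_le_smul_of_nonneg_left _ hr _ _ h := smul_le_smul_of_nonneg_left (β := E) h hr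
  smul_le_smul_of_nonneg_right _ hx _ _ h := smul_le_smul_of_nonneg_right (β := E) h hx

theorem isVLEmbedding_subtype (I : VLIdeal E) : IsVLEmbedding I.toSubmodule.subtype :=
  ⟨fun _ _ => rfl, fun _ _ => rfl, Subtype.val_injective⟩

theorem isOrderDense_range_subtype {I : VLIdeal E} (hI : IsOrderDense I.carrier) :
    IsOrderDense (Set.range I.toSubmodule.subtype) := fun x hx => by
  obtain ⟨y, hy, h⟩ := hI x hx
  exact ⟨y, ⟨⟨y, hy⟩, rfl⟩, h⟩

end VLIdeal

end Transfer

theorem exists_vlEquiv_orderDense_ideals (E : Type*) [AddCommGroup E]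
    [ConditionallyCompleteLattice E] [IsOrderedAddMonoid E] [Module ℝ E] [IsOrderedModule ℝ E] :
    ∃ (I : VLIdeal E) (J : VLIdeal (Orth E)),
      IsOrderDense I.carrier ∧ IsOrderDense J.carrier ∧
        Nonempty (VLEquiv I.toSubmodule J.toSubmodule) := by
  obtain ⟨S, hS⟩ := exists_isMaximalDisjoint E
  obtain ⟨g, -⟩ := exists_vlEquiv_of_nonneg_iff (G := hS.ideal.toSubmodule)
    (H := hS.orthIdeal.toSubmodule)
    (LinearEquiv.ofInjective hS.multiplication hS.multiplication_injective)
    (fun x => hS.multiplication_nonneg_iff)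
  exact ⟨hS.ideal, hS.orthIdeal, hS.isOrderDense_ideal, hS.isOrderDense_orthIdeal, ⟨g⟩⟩

theorem VLEquiv.isVLEmbedding {E F : Type*} [AddCommGroup E] [Lattice E] [Module ℝ E]
    [AddCommGroup F] [Lattice F] [Module ℝ F] (g : VLEquiv E F) :
    IsVLEmbedding (g.toLinearEquiv : E →ₗ[ℝ] F) :=
  ⟨g.map_sup', g.map_inf', g.toLinearEquiv.injective⟩

theorem mainTheorem10 {E : Type u} [AddCommGroup E] [ConditionallyCompleteLattice E]
    [IsOrderedAddMonoid E] [Module ℝ E] [IsOrderedModule ℝ E] :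
    (∃ (I : VLIdeal E) (J : VLIdeal (Orth E)),
      IsOrderDense I.carrier ∧ IsOrderDense J.carrier ∧
        Nonempty (VLEquiv I.toSubmodule J.toSubmodule)) ∧
    (∃ (U : Type u) (_ : AddCommGroup U) (_ : ConditionallyCompleteLattice U)
      (_ : IsOrderedAddMonoid U) (_ : Module ℝ U) (_ : IsOrderedModule ℝ U),
        IsUniversalCompletion E U) ∧
    (∃ (V : Type u) (_ : AddCommGroup V) (_ : ConditionallyCompleteLattice V)
      (_ : IsOrderedAddMonoid V) (_ : Module ℝ V) (_ : IsOrderedModule ℝ V),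
        IsUniversalCompletion (Orth E) V) ∧
    (∀ (U : Type v) [AddCommGroup U] [ConditionallyCompleteLattice U]
      [IsOrderedAddMonoid U] [Module ℝ U] [IsOrderedModule ℝ U]
      (V : Type w) [AddCommGroup V] [ConditionallyCompleteLattice V]
      [IsOrderedAddMonoid V] [Module ℝ V] [IsOrderedModule ℝ V],
        IsUniversalCompletion E U → IsUniversalCompletion (Orth E) V →
          Nonempty (VLEquiv U V)) := by
  have ideals := exists_vlEquiv_orderDense_ideals E
  refine ⟨ideals, ⟨BandProjection.GermSpace E, inferInstance, inferInstance, inferInstance,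
    inferInstance, inferInstance, BandProjection.GermSpace.isUniversalCompletion⟩, ?_, ?_⟩
  all_goals obtain ⟨I, J, hI, hJ, ⟨g⟩⟩ := ideals
  all_goals
    have hi : IsVLEmbedding (J.toSubmodule.subtype ∘ₗ
      (g.toLinearEquiv : I.toSubmodule →ₗ[ℝ] J.toSubmodule)) :=
      J.isVLEmbedding_subtype.comp g.isVLEmbedding
    have hid : IsOrderDense (Set.range (J.toSubmodule.subtype ∘ₗ
        (g.toLinearEquiv : I.toSubmodule →ₗ[ℝ] J.toSubmodule))) := by
      intro T hT
      obtain ⟨R, hR, h⟩ := hJ T hT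
      exact ⟨R, ⟨g.toLinearEquiv.symm ⟨R, hR⟩, by simp⟩, h⟩
  · obtain ⟨hU, k, hk, hkd⟩ := BandProjection.GermSpace.isUniversalCompletion (E := E)
    have hjd := IsOrderDense.range_comp hk hkd (VLIdeal.isOrderDense_range_subtype hI)
    -- The germ space of `E` serves `Orth E` as well: the embedding of `I` extends to `Orth E`, for
    -- which the Archimedean property is enough, and its range stays order dense because it contains
    -- the image of `I`.
    obtain ⟨T, hT, hTi⟩ := hi.exists_extension hid
      (Orth.isArchimedean (isArchimedean_of_conditionallyComplete E))
      (hk.comp I.isVLEmbedding_subtype) hjd hU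
    refine ⟨BandProjection.GermSpace E, inferInstance, inferInstance, inferInstance,
      inferInstance, inferInstance, hU, T, hT, fun x hx => ?_⟩
    obtain ⟨_, ⟨y, rfl⟩, hy⟩ := hjd x hx
    exact ⟨_, ⟨_, hTi y⟩, hy⟩
  · intro U _ _ _ _ _ V _ _ _ _ _ ⟨hU, k, hk, hkd⟩ ⟨hV, l, hl, hld⟩
    -- The common order dense sublattice is `I`, included in `E` and carried into `Orth E` by `g`.
    exact nonempty_vlEquiv_of_orderDense hU hV (hk.comp I.isVLEmbedding_subtype)
      (IsOrderDense.range_comp hk hkd (VLIdeal.isOrderDense_range_subtype hI))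
      (hl.comp hi) (IsOrderDense.range_comp hl hld hid)
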